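/- For real $\gamma,\varepsilon$ and $u\in C^2(\mathbb R^2)$ let $$L_{\gamma,\varepsilon}[u]=\bigl(2\varepsilon+(\gamma+1)u_x^2+(\gamma-1)u_y^2\bigr)u_{xx}+4u_xu_yu_{xy}+\bigl(2\varepsilon+(\gamma-1)u_x^2+(\gamma+1)u_y^2\bigr)u_{yy}.$$ The equation $L_{\gamma,\varepsilon}[u]=0$ over $\mathbb R^2$ has the Bernstein property if all its entire $C^2$-solutions (solutions in $C^2(\mathbb R^2)$) are affine linear. Let $\varepsilon\gamma>0$ and $|\gamma|\ge 1$, that is, $\gamma\ge 1,\ \varepsilon>0$ or $\gamma\le -1,\ \varepsilon<0$. For $w\ge 0$ put $$F_{\gamma,\varepsilon}(w)=\begin{cases}(2|\varepsilon|+|\gamma-1|w)^{\gamma/(\gamma-1)},&\gamma\ne 1,\\ e^{w/(2\varepsilon)},&\gamma=1,\end{cases}\qquad \lambda_{\gamma,\varepsilon}(w)=2\,\frac{F_{\gamma,\varepsilon}''(w)}{F_{\gamma,\varepsilon}'(w)}.$$ Then: 1. The equation $L_{\gamma,\varepsilon}[u]=0$ is elliptic: the determinant of its symmetric coefficient matrix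 is positive for every value of the gradient $(u_x,u_y)\in\mathbb R^2$. 2. The functional $\int_{\mathbb R^2}F_{\gamma,\varepsilon}(|Du|^2)\,dx$ is regular, i.e. $F_{\gamma,\varepsilon}$ is smooth at every $w\ge 0$, with $F_{\gamma,\varepsilon}'(w)>0$ and $F_{\gamma,\varepsilon}'(w)+2wF_{\gamma,\varepsilon}''(w)>0$. The equation $L_{\gamma,\varepsilon}[u]=0$ is its Euler–Lagrange equation: for $u\in C^2(\mathbb R^2)$, at each point $L_{\gamma,\varepsilon}[u]=0$ holds if and only if $\operatorname{div}\bigl(2F_{\gamma,\varepsilon}'(|Du|^2)Du\bigr)=0$ holds there; and $L_{\gamma,\varepsilon}[u]=0$ on $\mathbb R^2$ if and only if for every $\varphi\in C_c^\infty(\mathbb R^2)$ and every compact $K\supseteq\operatorname{supp}\varphi$ the derivative of $t\mapsto\int_K F_{\gamma,\varepsilon}(|D(u+t\varphi)|^2)\,dx$ at $t=0$ exists and is $0$. 3. For all $w\ge 0$ one has $2\varepsilon+(\gamma-1)w\neq 0$ and $\lambda_{\gamma,\varepsilon}(w)=\dfrac{2}{2\varepsilon+(\gamma-1)w}$, and for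 all $w\ge 1$ one has $2\varepsilon+\gamma w\ne 0$ and $$\frac{1+w\lambda_{\gamma,\varepsilon}(w)}{2+w\lambda_{\gamma,\varepsilon}(w)}\cdot\frac1w=\frac12\Bigl(\frac1{2\varepsilon+\gamma w}+\frac1w\Bigr).$$ 4. If moreover $\gamma\ne -1$ (that is, $\gamma\ge 1,\ \varepsilon>0$ or $\gamma<-1,\ \varepsilon<0$), then the associated Nitsche integral $$\int_1^\infty\frac{1+w\lambda_{\gamma,\varepsilon}(w)}{2+w\lambda_{\gamma,\varepsilon}(w)}\cdot\frac{dw}{w}=\int_1^\infty\frac12\Bigl(\frac1{2\varepsilon+\gamma w}+\frac1w\Bigr)dw$$ diverges to $+\infty$, the equation $L_{\gamma,\varepsilon}[u]=0$ has an entire $C^2$-solution that is not affine linear, and so it does not have the Bernstein property. -/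

import Mathlib

open MeasureTheory Filter Topology
open scoped ContDiff

namespace BernsteinPDE

/-! The plane is `ℝ × ℝ` with Lebesgue measure. Its Euclidean norm is never taken from Mathlib's
(sup) norm on the product: `|Du|²` is always written out as `u_x ^ 2 + u_y ^ 2`. -/

noncomputable section

/-- The partial derivative `u_x`. -/
def partialX (u : ℝ × ℝ → ℝ) (z : ℝ × ℝ) : ℝ := fderiv ℝ u z (1, 0)

/-- The partial derivative `u_y`. -/
def partialY (u : ℝ × ℝ → ℝ) (z : ℝ × ℝ) : ℝ := fderiv ℝ u z (0, 1)

/-- The gradient `Du = (u_x, u_y)`. -/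
def grad (u : ℝ × ℝ → ℝ) (z : ℝ × ℝ) : ℝ × ℝ := (partialX u z, partialY u z)

/-- The coefficient of `u_xx` in `L_{γ,ε}`, as a function of `p = Du`. -/
def coeffXX (γ ε : ℝ) (p : ℝ × ℝ) : ℝ :=
  2 * ε + (γ + 1) * p.1 ^ 2 + (γ - 1) * p.2 ^ 2

/-- Half of the coefficient of `u_xy` in `L_{γ,ε}`, as a function of `p = Du`. -/
def coeffXY (p : ℝ × ℝ) : ℝ := 2 * p.1 * p.2

/-- The coefficient of `u_yy` in `L_{γ,ε}`, as a function of `p = Du`. -/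
def coeffYY (γ ε : ℝ) (p : ℝ × ℝ) : ℝ :=
  2 * ε + (γ - 1) * p.1 ^ 2 + (γ + 1) * p.2 ^ 2

/-- The operator `L_{γ,ε}[u]`. -/
def L (γ ε : ℝ) (u : ℝ × ℝ → ℝ) (z : ℝ × ℝ) : ℝ :=
  coeffXX γ ε (grad u z) * partialX (partialX u) z
    + 2 * coeffXY (grad u z) * partialY (partialX u) z
    + coeffYY γ ε (grad u z) * partialY (partialY u) z

/-- Ellipticity of `L_{γ,ε}`: the symmetric coefficient matrix has positive determinant (that is,
it is definite) for every value of the gradient. -/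
def IsElliptic (γ ε : ℝ) : Prop :=
  ∀ p : ℝ × ℝ, 0 < coeffXX γ ε p * coeffYY γ ε p - coeffXY p ^ 2

/-- Affine linear functions on the plane. -/
def IsAffineLinear (u : ℝ × ℝ → ℝ) : Prop :=
  ∃ a b c : ℝ, ∀ z : ℝ × ℝ, u z = a * z.1 + b * z.2 + c

/-- `u` is an entire `C²`-solution of the equation `P[u] = 0`. -/
def IsEntireSolution (P : (ℝ × ℝ → ℝ) → ℝ × ℝ → ℝ) (u : ℝ × ℝ → ℝ) : Prop :=
  ContDiff ℝ 2 u ∧ ∀ z : ℝ × ℝ, P u z = 0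

/-- The Bernstein property of `P[u] = 0`: all entire `C²`-solutions are affine linear. -/
def HasBernsteinProperty (P : (ℝ × ℝ → ℝ) → ℝ × ℝ → ℝ) : Prop :=
  ∀ u : ℝ × ℝ → ℝ, IsEntireSolution P u → IsAffineLinear u

/-- The Lagrangian `p ↦ F(|p|²)`. -/
def lagrangian (F : ℝ → ℝ) (p : ℝ × ℝ) : ℝ := F (p.1 ^ 2 + p.2 ^ 2)

/-- The Euler–Lagrange operator `∂_x (f_{p₁}(Du)) + ∂_y (f_{p₂}(Du))` of the integral `∫ f(Du)`. -/
def eulerLagrange (f : ℝ × ℝ → ℝ) (u : ℝ × ℝ → ℝ) (z : ℝ × ℝ) : ℝ :=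
  partialX (fun y => partialX f (grad u y)) z + partialY (fun y => partialY f (grad u y)) z

/-- `u` is a stationary point of `∫ f(Du)`: the first variation vanishes in the direction of
every compactly supported smooth function. As the integral over the whole plane may be infinite,
it is taken over any compact set that contains the support of the variation. -/
def IsStationaryPoint (f : ℝ × ℝ → ℝ) (u : ℝ × ℝ → ℝ) : Prop :=
  ∀ φ : ℝ × ℝ → ℝ, ContDiff ℝ ∞ φ → HasCompactSupport φ →
    ∀ K : Set (ℝ × ℝ), IsCompact K → tsupport φ ⊆ K →
      HasDerivAt (fun t : ℝ => ∫ z in K, f (grad (fun y => u y + t * φ y) z)) 0 0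

/-- The function `F_{γ,ε}`. -/
def F (γ ε w : ℝ) : ℝ :=
  if γ = 1 then Real.exp (w / (2 * ε))
  else (2 * |ε| + |γ - 1| * w) ^ (γ / (γ - 1))

/-- `λ(w) = 2 F''(w) / F'(w)`. -/
def nitscheLambda (G : ℝ → ℝ) (w : ℝ) : ℝ := 2 * (deriv (deriv G) w / deriv G w)

/-- The integrand `(1 + w λ(w)) / (2 + w λ(w)) · 1 / w` of the Nitsche integral. -/
def nitscheIntegrand (G : ℝ → ℝ) (w : ℝ) : ℝ :=
  (1 + w * nitscheLambda G w) / (2 + w * nitscheLambda G w) * (1 / w)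

end

end BernsteinPDE

open BernsteinPDE

/-! The variational half rests on the identity F''/F' = 1/(2ε + (γ-1)w) for F = F_{γ,ε}. It makes
the Euler–Lagrange operator a nowhere vanishing multiple of L (`eulerLagrange_F`). The coefficient
matrix of L is (2ε + (γ-1)|p|²)·Id + 2 p⊗p, with eigenvalues 2ε + (γ±1)|p|². These have the same
sign, which gives both ellipticity and the regularity of F. The Nitsche integrand is at least c/w,
with c > 0 unless γ = -1.

The non-affine solution comes from the hodograph plane. The coefficients of L depend on Du alone, so
a Legendre transform U = U(p,q) has to satisfy a linear equation. The ansatz U = (p² - q²) G(p² +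
q²) reduces it to an ODE for G with parameters τ = (γ-1)/(2ε) ≥ 0 and κ = (γ+1)/(2ε) > 0; a positive
solution is linear for τ = 0 and hypergeometric otherwise (`exists_isProfile`).

To return to u, the map DU must be a diffeomorphism of the plane. Barrier arguments on the ODE give
G - sG' > 0 and sG' + βG > 0 for some β < 1/2; it is κ > 0 that leaves room for such a β. Together
they make the Hessian determinant of U negative, and the second one forces |DU| → ∞ at infinity.
Hence DU is a proper local diffeomorphism whose fibre over 0 is a single point, and
`exists_contDiff_inverse` supplies its inverse S. The Legendre transform u of U has Du = S, so it
solves L[u] = 0, and its gradient takes every value, so it is not affine. -/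

namespace BernsteinPDE

/-- The closed form of the derivative of `F`. -/
noncomputable def derivF (γ ε w : ℝ) : ℝ :=
  if γ = 1 then 1 / (2 * ε) * Real.exp (w / (2 * ε))
  else γ / (γ - 1) * |γ - 1| * (2 * |ε| + |γ - 1| * w) ^ (1 / (γ - 1))

/-! ### Closed forms for `F`, ellipticity and the Nitsche integral -/

section
variable {γ ε : ℝ}

lemma param_cases (hεγ : 0 < ε * γ) (hγ : 1 ≤ |γ|) : (0 < ε ∧ 1 ≤ γ) ∨ (ε < 0 ∧ γ ≤ -1) := by
  rcases pos_and_pos_or_neg_and_neg_of_mul_pos hεγ with ⟨h1, h2⟩ | ⟨h1, h2⟩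
  · exact Or.inl ⟨h1, by rwa [abs_of_pos h2] at hγ⟩
  · exact Or.inr ⟨h1, by rw [abs_of_neg h2] at hγ; linarith⟩

lemma base_pos (hεγ : 0 < ε * γ) {w : ℝ} (hw : 0 ≤ w) : 0 < 2 * |ε| + |γ - 1| * w := by
  have : ε ≠ 0 := by rintro rfl; simp at hεγ
  positivity

/-- Here σ is the sign of ε, which γ - 1 shares unless it is zero. It removes the absolute values
from `F`, so that both parameter ranges are treated together. -/
lemma base_eq (hεγ : 0 < ε * γ) (hγ : 1 ≤ |γ|) (w : ℝ) :
    ∃ σ : ℝ, σ ^ 2 = 1 ∧ 2 * |ε| + |γ - 1| * w = σ * (2 * ε + (γ - 1) * w) ∧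
      |γ - 1| = σ * (γ - 1) := by
  rcases param_cases hεγ hγ with ⟨h1, h2⟩ | ⟨h1, h2⟩
  · exact ⟨1, by norm_num, by rw [abs_of_pos h1, abs_of_nonneg (by linarith)]; ring,
      by rw [abs_of_nonneg (by linarith)]; ring⟩
  · exact ⟨-1, by norm_num, by rw [abs_of_neg h1, abs_of_neg (by linarith)]; ring,
      by rw [abs_of_neg (by linarith)]; ring⟩

lemma eventually_base_pos (hεγ : 0 < ε * γ) {w : ℝ} (hw : 0 ≤ w) :
    ∀ᶠ v in 𝓝 w, 0 < 2 * |ε| + |γ - 1| * v := by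
  have hc : Continuous fun v : ℝ => 2 * |ε| + |γ - 1| * v := by fun_prop
  exact hc.continuousAt.eventually (lt_mem_nhds (base_pos hεγ hw))

lemma hasDerivAt_F {w : ℝ} (hw : 0 < 2 * |ε| + |γ - 1| * w) :
    HasDerivAt (F γ ε) (derivF γ ε w) w := by
  unfold F derivF
  by_cases h : γ = 1
  · simp only [h, if_true]
    have := ((hasDerivAt_id w).div_const (2 * ε)).exp
    simpa [mul_comm] using this
  · simp only [h, if_false]
    have h1 : γ - 1 ≠ 0 := sub_ne_zero.mpr h
    have hb : HasDerivAt (fun v : ℝ => 2 * |ε| + |γ - 1| * v) (|γ - 1|) w := by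
      simpa using ((hasDerivAt_id w).const_mul (|γ - 1|)).const_add (2 * |ε|)
    have := hb.rpow_const (p := γ / (γ - 1)) (Or.inl hw.ne')
    convert this using 1
    have : γ / (γ - 1) - 1 = 1 / (γ - 1) := by field_simp; ring
    rw [this]; ring

/-- This is F'' = F'/(2ε + (γ-1)w). The sign σ enters through the base and through its derivative,
and cancels in the quotient. -/
lemma hasDerivAt_derivF (hεγ : 0 < ε * γ) (hγ : 1 ≤ |γ|) {w : ℝ}
    (hw : 0 < 2 * |ε| + |γ - 1| * w) :
    HasDerivAt (derivF γ ε) (derivF γ ε w / (2 * ε + (γ - 1) * w)) w := by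
  obtain ⟨σ, hσ, hb', hg⟩ := base_eq hεγ hγ w
  have hσ0 : σ ≠ 0 := by rintro rfl; norm_num at hσ
  unfold derivF
  by_cases h : γ = 1
  · simp only [h, if_true]
    have := (((hasDerivAt_id w).div_const (2 * ε)).exp).const_mul (1 / (2 * ε))
    refine this.congr_deriv ?_
    simp only [id, sub_self, zero_mul, add_zero]
    ring
  · simp only [h, if_false]
    have h1 : γ - 1 ≠ 0 := sub_ne_zero.mpr h
    have hb : HasDerivAt (fun v : ℝ => 2 * |ε| + |γ - 1| * v) (|γ - 1|) w := by
      simpa using ((hasDerivAt_id w).const_mul (|γ - 1|)).const_add (2 * |ε|)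
    have := (hb.rpow_const (p := 1 / (γ - 1)) (Or.inl hw.ne')).const_mul (γ / (γ - 1) * |γ - 1|)
    refine this.congr_deriv ?_
    have hq : 2 * ε + (γ - 1) * w ≠ 0 := by
      intro h0; rw [hb', h0, mul_zero] at hw; exact lt_irrefl _ hw
    rw [Real.rpow_sub_one hw.ne', hb', hg]
    generalize 2 * ε + (γ - 1) * w = q at *
    field_simp

lemma derivF_pos (hεγ : 0 < ε * γ) (hγ : 1 ≤ |γ|) {w : ℝ} (hw : 0 < 2 * |ε| + |γ - 1| * w) :
    0 < derivF γ ε w := by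
  unfold derivF
  by_cases h : γ = 1
  · have : 0 < ε := by simpa [h] using hεγ
    simp only [h, if_true]; positivity
  · simp only [h, if_false]
    have h1 : γ - 1 ≠ 0 := sub_ne_zero.mpr h
    have : 0 < γ / (γ - 1) := by
      rcases param_cases hεγ hγ with ⟨h2, h3⟩ | ⟨h2, h3⟩
      · have : 0 < γ - 1 := lt_of_le_of_ne (by linarith) h1.symm
        positivity
      · exact div_pos_of_neg_of_neg (by linarith) (by linarith)
    positivity

lemma contDiffAt_F {w : ℝ} (hw : 0 < 2 * |ε| + |γ - 1| * w) :
    ContDiffAt ℝ ∞ (F γ ε) w := by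
  unfold F
  by_cases h : γ = 1
  · simp only [h, if_true]; fun_prop
  · simp only [h, if_false]
    exact ContDiffAt.rpow_const_of_ne (by fun_prop) hw.ne'

lemma q_ne_zero (hεγ : 0 < ε * γ) (hγ : 1 ≤ |γ|) {w : ℝ} (hw : 0 ≤ w) :
    2 * ε + (γ - 1) * w ≠ 0 := by
  obtain ⟨σ, -, hb, -⟩ := base_eq hεγ hγ w
  intro h0
  have := base_pos hεγ hw
  rw [hb, h0, mul_zero] at this
  exact lt_irrefl _ this

/-- Numerator and denominator are the two eigenvalues of the coefficient matrix at |p|² = w. Their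
ratio is also (F' + 2wF'')/F', so one inequality serves ellipticity and regularity. -/
lemma q_mul_pos (hεγ : 0 < ε * γ) (hγ : 1 ≤ |γ|) {w : ℝ} (hw : 0 ≤ w) :
    0 < (2 * ε + (γ + 1) * w) / (2 * ε + (γ - 1) * w) := by
  rcases param_cases hεγ hγ with ⟨h1, h2⟩ | ⟨h1, h2⟩
  · have : 0 ≤ γ - 1 := by linarith
    have : 0 < γ + 1 := by linarith
    positivity
  · apply div_pos_of_neg_of_neg <;> nlinarith

lemma deriv_F_eventuallyEq (hεγ : 0 < ε * γ) {w : ℝ} (hw : 0 ≤ w) :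
    deriv (F γ ε) =ᶠ[𝓝 w] derivF γ ε :=
  (eventually_base_pos hεγ hw).mono fun _ hv => (hasDerivAt_F hv).deriv

lemma deriv_F (hεγ : 0 < ε * γ) {w : ℝ} (hw : 0 ≤ w) : deriv (F γ ε) w = derivF γ ε w :=
  (hasDerivAt_F (base_pos hεγ hw)).deriv

lemma deriv_deriv_F (hεγ : 0 < ε * γ) (hγ : 1 ≤ |γ|) {w : ℝ} (hw : 0 ≤ w) :
    deriv (deriv (F γ ε)) w = derivF γ ε w / (2 * ε + (γ - 1) * w) :=
  (deriv_F_eventuallyEq hεγ hw).deriv_eq.trans (hasDerivAt_derivF hεγ hγ (base_pos hεγ hw)).deriv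

theorem isElliptic_of_param (hεγ : 0 < ε * γ) (hγ : 1 ≤ |γ|) : IsElliptic γ ε := by
  intro p
  have hw : 0 ≤ p.1 ^ 2 + p.2 ^ 2 := by positivity
  have h := q_mul_pos hεγ hγ hw
  have hq := q_ne_zero hεγ hγ hw
  have : coeffXX γ ε p * coeffYY γ ε p - coeffXY p ^ 2 =
      (2 * ε + (γ + 1) * (p.1 ^ 2 + p.2 ^ 2)) / (2 * ε + (γ - 1) * (p.1 ^ 2 + p.2 ^ 2)) *
        (2 * ε + (γ - 1) * (p.1 ^ 2 + p.2 ^ 2)) ^ 2 := by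
    field_simp
    simp only [coeffXX, coeffYY, coeffXY]
    ring
  rw [this]
  positivity

theorem F_regular (hεγ : 0 < ε * γ) (hγ : 1 ≤ |γ|) {w : ℝ} (hw : 0 ≤ w) :
    ContDiffAt ℝ ∞ (F γ ε) w ∧ 0 < deriv (F γ ε) w ∧
      0 < deriv (F γ ε) w + 2 * w * deriv (deriv (F γ ε)) w := by
  have hb := base_pos hεγ hw
  refine ⟨contDiffAt_F hb, ?_, ?_⟩
  · rw [deriv_F hεγ hw]; exact derivF_pos hεγ hγ hb
  · rw [deriv_deriv_F hεγ hγ hw, deriv_F hεγ hw]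
    have hq := q_ne_zero hεγ hγ hw
    have : derivF γ ε w + 2 * w * (derivF γ ε w / (2 * ε + (γ - 1) * w)) =
        derivF γ ε w * ((2 * ε + (γ + 1) * w) / (2 * ε + (γ - 1) * w)) := by
      rw [show 2 * ε + (γ + 1) * w = 2 * ε + (γ - 1) * w + 2 * w by ring]
      generalize 2 * ε + (γ - 1) * w = q at *
      field_simp
    rw [this]
    exact mul_pos (derivF_pos hεγ hγ hb) (q_mul_pos hεγ hγ hw)

theorem nitscheLambda_F (hεγ : 0 < ε * γ) (hγ : 1 ≤ |γ|) {w : ℝ} (hw : 0 ≤ w) :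
    nitscheLambda (F γ ε) w = 2 / (2 * ε + (γ - 1) * w) := by
  have hF := (derivF_pos hεγ hγ (base_pos hεγ hw)).ne'
  rw [nitscheLambda, deriv_deriv_F hεγ hγ hw, deriv_F hεγ hw]
  field_simp

lemma two_mul_add_ne_zero (hεγ : 0 < ε * γ) (hγ : 1 ≤ |γ|) {w : ℝ} (hw : 1 ≤ w) :
    2 * ε + γ * w ≠ 0 := by
  rcases param_cases hεγ hγ with ⟨h1, h2⟩ | ⟨h1, h2⟩
  · positivity
  · nlinarith

theorem nitscheIntegrand_F (hεγ : 0 < ε * γ) (hγ : 1 ≤ |γ|) {w : ℝ} (hw : 1 ≤ w) :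
    nitscheIntegrand (F γ ε) w = 1 / 2 * (1 / (2 * ε + γ * w) + 1 / w) := by
  have hw0 : 0 ≤ w := by linarith
  have hq := q_ne_zero hεγ hγ hw0
  have hr := two_mul_add_ne_zero hεγ hγ hw
  have hw' : w ≠ 0 := by positivity
  rw [nitscheIntegrand, nitscheLambda_F hεγ hγ hw0]
  obtain ⟨q, hqe⟩ : ∃ q, q = 2 * ε + (γ - 1) * w := ⟨_, rfl⟩
  have hqr : 2 * ε + γ * w = q + w := by rw [hqe]; ring
  rw [hqr] at hr ⊢
  rw [← hqe] at hq ⊢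
  have h2 : 2 + w * (2 / q) = 2 * (q + w) / q := by field_simp
  rw [h2]
  field_simp
  ring

theorem tendsto_nitscheIntegral (hεγ : 0 < ε * γ) (hγ : 1 ≤ |γ|) (hγ' : γ ≠ -1) :
    Tendsto (fun R : ℝ => ∫ w in (1 : ℝ)..R, 1 / 2 * (1 / (2 * ε + γ * w) + 1 / w))
      atTop atTop := by
  -- Comparison with c·log R. For γ ≥ 1 the first summand is nonnegative and c = 1/2 works. For γ <
  -- -1 it is at least 1/(γw), which leaves c = (1 + 1/γ)/2; this would vanish at γ = -1.
  obtain ⟨c, hc, hle⟩ : ∃ c : ℝ, 0 < c ∧ ∀ w : ℝ, 1 ≤ w →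
      c * (1 / w) ≤ 1 / 2 * (1 / (2 * ε + γ * w) + 1 / w) := by
    rcases param_cases hεγ hγ with ⟨h1, h2⟩ | ⟨h1, h2⟩
    · refine ⟨1 / 2, by norm_num, fun w hw => ?_⟩
      have : 0 ≤ 1 / (2 * ε + γ * w) := by positivity
      linarith
    · have h3 : γ < -1 := lt_of_le_of_ne h2 hγ'
      refine ⟨1 / 2 * (1 + 1 / γ), ?_, fun w hw => ?_⟩
      · have : -1 < 1 / γ := by rw [lt_div_iff_of_neg (by linarith)]; linarith
        linarith
      · have hγw : γ * w < 0 := by nlinarith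
        have h4 : 1 / (γ * w) ≤ 1 / (2 * ε + γ * w) :=
          one_div_le_one_div_of_neg_of_le hγw (by linarith)
        have h5 : 1 / γ * (1 / w) = 1 / (γ * w) := by
          have : γ ≠ 0 := by linarith
          have : w ≠ 0 := by linarith
          field_simp
        linarith
  have hlog : Tendsto (fun R : ℝ => c * Real.log R) atTop atTop :=
    Real.tendsto_log_atTop.const_mul_atTop hc
  refine tendsto_atTop_mono' _ ?_ hlog
  filter_upwards [eventually_ge_atTop 1] with R hR
  have h0 : ∀ w ∈ Set.uIcc 1 R, 1 ≤ w := fun w hw => by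
    rw [Set.uIcc_of_le hR] at hw; exact hw.1
  have hint : ∫ w in (1 : ℝ)..R, c * (1 / w) = c * Real.log R := by
    rw [intervalIntegral.integral_const_mul, integral_one_div_of_pos one_pos (by linarith), div_one]
  rw [← hint]
  apply intervalIntegral.integral_mono_on hR
  · apply ContinuousOn.intervalIntegrable
    exact continuousOn_const.mul
      (continuousOn_const.div continuousOn_id fun w hw => by have := h0 w hw; simp; linarith)
  · apply ContinuousOn.intervalIntegrable
    exact continuousOn_const.mul
      ((continuousOn_const.div (by fun_prop) fun w hw => two_mul_add_ne_zero hεγ hγ (h0 w hw)).add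
      (continuousOn_const.div continuousOn_id fun w hw => by have := h0 w hw; simp; linarith))
  · intro w hw; exact hle w hw.1

theorem tendsto_nitscheIntegral_F (hεγ : 0 < ε * γ) (hγ : 1 ≤ |γ|) (hγ' : γ ≠ -1) :
    Tendsto (fun R : ℝ => ∫ w in (1 : ℝ)..R, nitscheIntegrand (F γ ε) w) atTop atTop := by
  refine (tendsto_nitscheIntegral hεγ hγ hγ').congr' ?_
  filter_upwards [eventually_ge_atTop 1] with R hR
  refine intervalIntegral.integral_congr fun w hw => ?_
  rw [Set.uIcc_of_le hR] at hw
  exact (nitscheIntegrand_F hεγ hγ hw.1).symm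

end

/-! ### Calculus in the plane and the first variation -/

lemma contDiff_partialX {n m : WithTop ℕ∞} {u : ℝ × ℝ → ℝ} (hu : ContDiff ℝ n u)
    (h : m + 1 ≤ n) : ContDiff ℝ m (partialX u) :=
  (hu.fderiv_right h).clm_apply contDiff_const

lemma contDiff_partialY {n m : WithTop ℕ∞} {u : ℝ × ℝ → ℝ} (hu : ContDiff ℝ n u)
    (h : m + 1 ≤ n) : ContDiff ℝ m (partialY u) :=
  (hu.fderiv_right h).clm_apply contDiff_const

lemma contDiff_grad {n m : WithTop ℕ∞} {u : ℝ × ℝ → ℝ} (hu : ContDiff ℝ n u)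
    (h : m + 1 ≤ n) : ContDiff ℝ m (grad u) :=
  (contDiff_partialX hu h).prodMk (contDiff_partialY hu h)

lemma fderiv_apply_eq (f : ℝ × ℝ → ℝ) (p v : ℝ × ℝ) :
    fderiv ℝ f p v = v.1 * partialX f p + v.2 * partialY f p := by
  have : v = v.1 • ((1 : ℝ), (0 : ℝ)) + v.2 • ((0 : ℝ), (1 : ℝ)) := by ext <;> simp
  conv_lhs => rw [this]
  simp only [map_add, map_smul, smul_eq_mul, partialX, partialY]

lemma partialX_partialY_comm {u : ℝ × ℝ → ℝ} (hu : ContDiff ℝ 2 u) (z : ℝ × ℝ) :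
    partialX (partialY u) z = partialY (partialX u) z := by
  have hd : DifferentiableAt ℝ (fderiv ℝ u) z :=
    ((hu.fderiv_right (m := 1) (by norm_num)).differentiable (by norm_num)) z
  have key : ∀ v w : ℝ × ℝ, fderiv ℝ (fun y => fderiv ℝ u y v) z w
      = fderiv ℝ (fderiv ℝ u) z w v := fun v w => by
    rw [fderiv_clm_apply hd (differentiableAt_const v)]
    simp
  have hs : IsSymmSndFDerivAt ℝ u z := hu.contDiffAt.isSymmSndFDerivAt (by simp)
  change fderiv ℝ (fun y => fderiv ℝ u y (0, 1)) z (1, 0)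
    = fderiv ℝ (fun y => fderiv ℝ u y (1, 0)) z (0, 1)
  rw [key, key]
  exact hs _ _

lemma grad_add_mul {u φ : ℝ × ℝ → ℝ} (hu : Differentiable ℝ u) (hφ : Differentiable ℝ φ)
    (t : ℝ) (z : ℝ × ℝ) :
    grad (fun y => u y + t * φ y) z = grad u z + t • grad φ z := by
  have : fderiv ℝ (fun y => u y + t * φ y) z = fderiv ℝ u z + t • fderiv ℝ φ z := by
    rw [fderiv_fun_add (hu z) ((hφ z).const_mul t), fderiv_const_mul (hφ z)]
  ext <;> simp [grad, partialX, partialY, this]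

lemma grad_eq_zero_of_notMem_tsupport {φ : ℝ × ℝ → ℝ} {z : ℝ × ℝ} (hz : z ∉ tsupport φ) :
    grad φ z = 0 := by
  simp [grad, partialX, partialY, fderiv_of_notMem_tsupport ℝ hz]

/-- The first variation of `∫_K f(Du)`. -/
lemma hasDerivAt_integral_lagrangian {f u φ : ℝ × ℝ → ℝ} (hf : ContDiff ℝ 1 f)
    (hu : ContDiff ℝ 1 u) (hφ : ContDiff ℝ 1 φ) {K : Set (ℝ × ℝ)} (hK : IsCompact K) :
    HasDerivAt (fun t : ℝ => ∫ z in K, f (grad (fun y => u y + t * φ y) z))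
      (∫ z in K, fderiv ℝ f (grad u z) (grad φ z)) 0 := by
  have hgu : Continuous (grad u) := (contDiff_grad (m := 0) hu (by simp)).continuous
  have hgφ : Continuous (grad φ) := (contDiff_grad (m := 0) hφ (by simp)).continuous
  have hfd : Continuous (fderiv ℝ f) := hf.continuous_fderiv (by norm_num)
  have hD : Continuous fun q : ℝ × (ℝ × ℝ) =>
      fderiv ℝ f (grad u q.2 + q.1 • grad φ q.2) (grad φ q.2) := by fun_prop
  -- The t-derivative of the integrand is jointly continuous, so it is bounded on [-1,1] × K. This
  -- constant dominates when differentiating under the integral.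
  obtain ⟨C, hC⟩ := ((isCompact_closedBall (0 : ℝ) 1).prod hK).exists_bound_of_continuousOn
    hD.continuousOn
  have hfin : IsFiniteMeasure (volume.restrict K) :=
    ⟨by simpa using hK.measure_lt_top⟩
  simp only [grad_add_mul (hu.differentiable (by norm_num)) (hφ.differentiable (by norm_num))]
  have hcont : ∀ t : ℝ, Continuous fun z => f (grad u z + t • grad φ z) := fun t =>
    hf.continuous.comp (by fun_prop)
  have := (hasDerivAt_integral_of_dominated_loc_of_deriv_le (μ := volume.restrict K)
    (F := fun (t : ℝ) z => f (grad u z + t • grad φ z))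
    (F' := fun (t : ℝ) z => fderiv ℝ f (grad u z + t • grad φ z) (grad φ z))
    (bound := fun _ => C) (Metric.ball_mem_nhds (0 : ℝ) one_pos)
    (Eventually.of_forall fun t => (hcont t).aestronglyMeasurable)
    ((hcont 0).continuousOn.integrableOn_compact hK)
    (by
      have : Continuous fun z => fderiv ℝ f (grad u z + (0 : ℝ) • grad φ z) (grad φ z) := by
        fun_prop
      exact this.aestronglyMeasurable)
    (ae_restrict_of_forall_mem hK.measurableSet fun z hz t ht =>
      hC (t, z) ⟨Metric.ball_subset_closedBall ht, hz⟩)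
    (integrable_const C)
    (Eventually.of_forall fun z t _ => by
      have h1 : HasDerivAt (fun t : ℝ => grad u z + t • grad φ z) (grad φ z) t := by
        simpa using ((hasDerivAt_id t).smul_const (grad φ z)).const_add (grad u z)
      exact ((hf.differentiable (by norm_num)) _).hasFDerivAt.comp_hasDerivAt t h1)).2
  simpa using this

/-- Integration by parts in each coordinate. The integral over K is first extended to the plane,
where the compact support of φ removes boundary terms. -/
lemma integral_firstVariation {f u φ : ℝ × ℝ → ℝ} (hf : ContDiff ℝ 2 f)
    (hu : ContDiff ℝ 2 u) (hφ : ContDiff ℝ ∞ φ) (hc : HasCompactSupport φ)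
    {K : Set (ℝ × ℝ)} (hK : tsupport φ ⊆ K) :
    ∫ z in K, fderiv ℝ f (grad u z) (grad φ z) = - ∫ z, φ z • eulerLagrange f u z := by
  have hφ1 : ContDiff ℝ 1 φ := hφ.of_le (by exact_mod_cast le_top)
  have hgu : ContDiff ℝ 1 (grad u) := contDiff_grad hu (by norm_num)
  have hA : ContDiff ℝ 1 fun y => partialX f (grad u y) :=
    (contDiff_partialX hf (by norm_num)).comp hgu
  have hB : ContDiff ℝ 1 fun y => partialY f (grad u y) :=
    (contDiff_partialY hf (by norm_num)).comp hgu
  rw [setIntegral_eq_integral_of_forall_compl_eq_zero fun z hz => by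
    rw [grad_eq_zero_of_notMem_tsupport fun h => hz (hK h), map_zero]]
  have hpart : ∀ (A : ℝ × ℝ → ℝ) (v : ℝ × ℝ), ContDiff ℝ 1 A →
      Integrable (fun z => A z * fderiv ℝ φ z v) ∧ Integrable (fun z => fderiv ℝ A z v * φ z) ∧
      ∫ z, A z * fderiv ℝ φ z v = - ∫ z, fderiv ℝ A z v * φ z := by
    intro A v hA
    have hφd : Continuous fun z => fderiv ℝ φ z v :=
      (hφ1.continuous_fderiv (by norm_num)).clm_apply continuous_const
    have hAd : Continuous fun z => fderiv ℝ A z v :=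
      (hA.continuous_fderiv (by norm_num)).clm_apply continuous_const
    have i1 : Integrable (fun z => A z * fderiv ℝ φ z v) :=
      (hA.continuous.mul hφd).integrable_of_hasCompactSupport (hc.fderiv_apply (𝕜 := ℝ) v).mul_left
    have i2 : Integrable (fun z => fderiv ℝ A z v * φ z) :=
      (hAd.mul hφ.continuous).integrable_of_hasCompactSupport hc.mul_left
    have i3 : Integrable (fun z => A z * φ z) :=
      (hA.continuous.mul hφ.continuous).integrable_of_hasCompactSupport hc.mul_left
    exact ⟨i1, i2, integral_mul_fderiv_eq_neg_fderiv_mul_of_integrable i2 i1 i3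
      (fun z _ => hA.differentiable (by norm_num) z)
      (fun z _ => hφ1.differentiable (by norm_num) z)⟩
  obtain ⟨a1, a2, a3⟩ := hpart _ (1, 0) hA
  obtain ⟨b1, b2, b3⟩ := hpart _ (0, 1) hB
  have e1 : (fun z => fderiv ℝ f (grad u z) (grad φ z)) = fun z =>
      partialX f (grad u z) * fderiv ℝ φ z (1, 0) + partialY f (grad u z) * fderiv ℝ φ z (0, 1) := by
    funext z
    rw [fderiv_apply_eq]
    simp only [grad, partialX, partialY]
    ring
  have e2 : (fun z => φ z • eulerLagrange f u z) = fun z =>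
      fderiv ℝ (fun y => partialX f (grad u y)) z (1, 0) * φ z +
        fderiv ℝ (fun y => partialY f (grad u y)) z (0, 1) * φ z := by
    funext z
    rw [eulerLagrange, smul_eq_mul, partialX, partialY]
    ring
  rw [e1, e2, integral_add a1 b1, integral_add a2 b2, a3, b3]
  ring

/-- For a `C²` Lagrangian, stationary points are the solutions of the Euler–Lagrange equation. -/
theorem isStationaryPoint_iff {f u : ℝ × ℝ → ℝ} (hf : ContDiff ℝ 2 f) (hu : ContDiff ℝ 2 u) :
    IsStationaryPoint f u ↔ ∀ z, eulerLagrange f u z = 0 := by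
  have hgu : ContDiff ℝ 1 (grad u) := contDiff_grad hu (by norm_num)
  have hvar : ∀ φ : ℝ × ℝ → ℝ, ContDiff ℝ ∞ φ → HasCompactSupport φ →
      ∀ K : Set (ℝ × ℝ), IsCompact K → tsupport φ ⊆ K →
      HasDerivAt (fun t : ℝ => ∫ z in K, f (grad (fun y => u y + t * φ y) z))
        (- ∫ z, φ z • eulerLagrange f u z) 0 := fun φ hφ hc K hK hs => by
    rw [← integral_firstVariation hf hu hφ hc hs]
    exact hasDerivAt_integral_lagrangian (hf.of_le (by norm_num)) (hu.of_le (by norm_num))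
      (hφ.of_le (by exact_mod_cast le_top)) hK
  constructor
  · intro h
    have hcont : Continuous (eulerLagrange f u) := by
      have hA : ContDiff ℝ 1 fun y => partialX f (grad u y) :=
        (contDiff_partialX hf (by norm_num)).comp hgu
      have hB : ContDiff ℝ 1 fun y => partialY f (grad u y) :=
        (contDiff_partialY hf (by norm_num)).comp hgu
      exact (contDiff_partialX (m := 0) hA (by simp)).continuous.add
        (contDiff_partialY (m := 0) hB (by simp)).continuous
    -- The fundamental lemma of the calculus of variations; continuity then upgrades almost
    -- everywhere to everywhere.
    have hae : ∀ᵐ z : ℝ × ℝ, eulerLagrange f u z = 0 :=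
      ae_eq_zero_of_integral_contDiff_smul_eq_zero hcont.locallyIntegrable fun φ hφ hc => by
        have h1 := h φ hφ hc _ hc.isCompact subset_rfl
        have h2 := hvar φ hφ hc _ hc.isCompact subset_rfl
        exact neg_eq_zero.mp (h2.unique h1)
    exact fun z => congrFun ((hcont.ae_eq_iff_eq volume continuous_const).mp hae) z
  · intro h φ hφ hc K hK hs
    simpa [h] using hvar φ hφ hc K hK hs

/-! ### The Euler–Lagrange equation of ∫ F(|Du|²) -/

section
variable {γ ε : ℝ}

lemma contDiff_lagrangian_F (hεγ : 0 < ε * γ) : ContDiff ℝ ∞ (lagrangian (F γ ε)) := by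
  rw [contDiff_iff_contDiffAt]
  intro p
  have h : ContDiffAt ℝ ∞ (fun p : ℝ × ℝ => p.1 ^ 2 + p.2 ^ 2) p := by fun_prop
  exact (contDiffAt_F (base_pos hεγ (by positivity))).comp p h

lemma grad_lagrangian_F (hεγ : 0 < ε * γ) (p : ℝ × ℝ) :
    partialX (lagrangian (F γ ε)) p = 2 * derivF γ ε (p.1 ^ 2 + p.2 ^ 2) * p.1 ∧
    partialY (lagrangian (F γ ε)) p = 2 * derivF γ ε (p.1 ^ 2 + p.2 ^ 2) * p.2 := by
  have hw : HasFDerivAt (fun p : ℝ × ℝ => p.1 ^ 2 + p.2 ^ 2) _ p :=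
    ((hasFDerivAt_fst (𝕜 := ℝ) (p := p)).pow 2).add ((hasFDerivAt_snd (𝕜 := ℝ) (p := p)).pow 2)
  have := (hasDerivAt_F (γ := γ) (base_pos hεγ
    (by positivity : 0 ≤ p.1 ^ 2 + p.2 ^ 2))).comp_hasFDerivAt p hw
  have h2 : fderiv ℝ (lagrangian (F γ ε)) p = _ := this.fderiv
  constructor <;> simp [partialX, partialY, h2] <;> ring

/-- The Euler–Lagrange operator of `∫ F(|Du|²)` is a positive or negative multiple of `L`. -/
lemma eulerLagrange_F (hεγ : 0 < ε * γ) (hγ : 1 ≤ |γ|) {u : ℝ × ℝ → ℝ} (hu : ContDiff ℝ 2 u)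
    (z : ℝ × ℝ) :
    eulerLagrange (lagrangian (F γ ε)) u z =
      2 * derivF γ ε (partialX u z ^ 2 + partialY u z ^ 2) /
        (2 * ε + (γ - 1) * (partialX u z ^ 2 + partialY u z ^ 2)) * L γ ε u z := by
  have hw0 : 0 ≤ partialX u z ^ 2 + partialY u z ^ 2 := by positivity
  have hq := q_ne_zero hεγ hγ hw0
  have ha : HasFDerivAt (partialX u) (fderiv ℝ (partialX u) z) z :=
    ((contDiff_partialX (m := 1) hu (by norm_num)).differentiable (by norm_num) z).hasFDerivAt
  have hb : HasFDerivAt (partialY u) (fderiv ℝ (partialY u) z) z :=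
    ((contDiff_partialY (m := 1) hu (by norm_num)).differentiable (by norm_num) z).hasFDerivAt
  have hF := (((hasDerivAt_derivF hεγ hγ (base_pos hεγ hw0)).comp_hasFDerivAt z
    ((ha.pow 2).add (hb.pow 2))).const_mul 2)
  have e1 : (fun y => partialX (lagrangian (F γ ε)) (grad u y)) =
      fun y => 2 * derivF γ ε (partialX u y ^ 2 + partialY u y ^ 2) * partialX u y :=
    funext fun y => (grad_lagrangian_F hεγ _).1
  have e2 : (fun y => partialY (lagrangian (F γ ε)) (grad u y)) =
      fun y => 2 * derivF γ ε (partialX u y ^ 2 + partialY u y ^ 2) * partialY u y :=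
    funext fun y => (grad_lagrangian_F hεγ _).2
  have d1 := (hF.mul ha).fderiv
  have d2 := (hF.mul hb).fderiv
  have hxy : fderiv ℝ (partialY u) z (1, 0) = fderiv ℝ (partialX u) z (0, 1) :=
    partialX_partialY_comm hu z
  have p1 : partialX (fun y => partialX (lagrangian (F γ ε)) (grad u y)) z = _ :=
    (congrArg (fun g => fderiv ℝ g z (1, 0)) e1).trans (congrArg (fun A => A (1, 0)) d1)
  have p2 : partialY (fun y => partialY (lagrangian (F γ ε)) (grad u y)) z = _ :=
    (congrArg (fun g => fderiv ℝ g z (0, 1)) e2).trans (congrArg (fun A => A (0, 1)) d2)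
  rw [eulerLagrange, p1, p2]
  simp only [L, coeffXX, coeffXY, coeffYY, grad]
  simp only [add_apply, smul_apply, smul_eq_mul, hxy]
  change _ = _ * (_ * fderiv ℝ (partialX u) z (1, 0) + _ * fderiv ℝ (partialX u) z (0, 1)
    + _ * fderiv ℝ (partialY u) z (0, 1))
  simp only [Function.comp, Pi.add_apply]
  obtain ⟨q, hqe⟩ : ∃ q, q = 2 * ε + (γ - 1) * (partialX u z ^ 2 + partialY u z ^ 2) := ⟨_, rfl⟩
  rw [← hqe] at hq ⊢
  rw [show 2 * ε + (γ + 1) * partialX u z ^ 2 + (γ - 1) * partialY u z ^ 2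
      = q + 2 * partialX u z ^ 2 by rw [hqe]; ring,
    show 2 * ε + (γ - 1) * partialX u z ^ 2 + (γ + 1) * partialY u z ^ 2
      = q + 2 * partialY u z ^ 2 by rw [hqe]; ring]
  simp only [Nat.add_one_sub_one, pow_one, nsmul_eq_mul, Nat.cast_ofNat]
  field_simp
  ring

theorem eulerLagrange_F_eq_zero_iff (hεγ : 0 < ε * γ) (hγ : 1 ≤ |γ|) {u : ℝ × ℝ → ℝ}
    (hu : ContDiff ℝ 2 u) (z : ℝ × ℝ) :
    eulerLagrange (lagrangian (F γ ε)) u z = 0 ↔ L γ ε u z = 0 := by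
  have hw0 : 0 ≤ partialX u z ^ 2 + partialY u z ^ 2 := by positivity
  have hF := (derivF_pos hεγ hγ (base_pos hεγ hw0)).ne'
  rw [eulerLagrange_F hεγ hγ hu, mul_eq_zero, or_iff_right]
  exact div_ne_zero (mul_ne_zero two_ne_zero hF) (q_ne_zero hεγ hγ hw0)

end

/-! ### Power series with radius of convergence at least one -/

/-- The coefficients of the formal derivative. -/
def derivCoeff (a : ℕ → ℝ) (n : ℕ) : ℝ := (n + 1) * a (n + 1)

/-- The power series with coefficients `a` converges absolutely on the open unit disc. -/
def UnitSummable (a : ℕ → ℝ) : Prop := ∀ r : ℝ, 0 ≤ r → r < 1 → Summable fun n => |a n| * r ^ n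

lemma UnitSummable.summable {a : ℕ → ℝ} (ha : UnitSummable a) {z : ℝ} (hz : z ∈ Set.Ioo (-1 : ℝ) 1) :
    Summable fun n => a n * z ^ n := by
  refine Summable.of_norm ?_
  simpa [abs_mul, abs_pow] using ha |z| (abs_nonneg z) (abs_lt.mpr hz)

/-- For r < ρ < 1 the terms |aₙ|ρⁿ are bounded, so the derived series at r is dominated by a
multiple of Σ (n+1)(r/ρ)ⁿ. -/
lemma UnitSummable.derived {a : ℕ → ℝ} (ha : UnitSummable a) : UnitSummable (derivCoeff a) := by
  intro r hr0 hr1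
  obtain ⟨ρ, h1, h2⟩ := exists_between hr1
  have hρ : 0 < ρ := hr0.trans_lt h1
  have hlim := (ha ρ hρ.le h2).tendsto_atTop_zero
  obtain ⟨M, hM⟩ := hlim.bddAbove_range
  have hM' : ∀ n, |a n| * ρ ^ n ≤ M := fun n => hM ⟨n, rfl⟩
  have hq : ‖r / ρ‖ < 1 := by
    rw [Real.norm_eq_abs, abs_of_nonneg (by positivity), div_lt_one hρ]; exact h1
  have hs : Summable fun n : ℕ => M / ρ * (((n : ℝ) + 1) * (r / ρ) ^ n) := by
    refine Summable.mul_left _ ?_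
    have := (summable_pow_mul_geometric_of_norm_lt_one 1 hq).add
      (summable_geometric_of_norm_lt_one hq)
    refine this.congr fun n => ?_
    ring
  refine Summable.of_nonneg_of_le (fun n => by positivity) (fun n => ?_) hs
  have h3 : |a (n + 1)| ≤ M / ρ ^ (n + 1) := by rw [le_div_iff₀ (by positivity)]; exact hM' _
  rw [derivCoeff, abs_mul, abs_of_nonneg (by positivity : (0 : ℝ) ≤ (n : ℝ) + 1)]
  calc ((n : ℝ) + 1) * |a (n + 1)| * r ^ n ≤ ((n : ℝ) + 1) * (M / ρ ^ (n + 1)) * r ^ n := by gcongr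
    _ = _ := by rw [div_pow]; field_simp; ring

lemma UnitSummable.hasDerivAt {a : ℕ → ℝ} (ha : UnitSummable a) {z : ℝ}
    (hz : z ∈ Set.Ioo (-1 : ℝ) 1) :
    HasDerivAt (fun z => ∑' n, a n * z ^ n) (∑' n, derivCoeff a n * z ^ n) z := by
  obtain ⟨r, h1, h2⟩ := exists_between (abs_lt.mpr hz)
  have hr : 0 < r := (abs_nonneg z).trans_lt h1
  have hs : Summable fun n : ℕ => |a n| * (n * r ^ (n - 1)) := by
    refine (summable_nat_add_iff 1).mp ?_
    refine (ha.derived r hr.le h2).congr fun n => ?_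
    rw [derivCoeff, abs_mul, abs_of_nonneg (by positivity : (0 : ℝ) ≤ (n : ℝ) + 1)]
    push_cast
    ring
  have hzr : z ∈ Set.Ioo (-r) r := abs_lt.mp h1
  have := hasDerivAt_tsum_of_isPreconnected (g := fun n z => a n * z ^ n)
    (g' := fun n z => a n * (n * z ^ (n - 1))) hs isOpen_Ioo isPreconnected_Ioo
    (fun n y _ => (hasDerivAt_pow n y).const_mul (a n))
    (fun n y hy => by
      rw [Real.norm_eq_abs, abs_mul, abs_mul, abs_pow, Nat.abs_cast]
      have : |y| ≤ r := (abs_lt.mpr hy).le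
      gcongr) hzr (ha.summable hz) hzr
  refine this.congr_deriv ?_
  have hs' : Summable fun n : ℕ => a n * (n * z ^ (n - 1)) := by
    refine (summable_nat_add_iff 1).mp ((ha.derived.summable hz).congr fun n => ?_)
    rw [derivCoeff]; push_cast; ring
  rw [hs'.tsum_eq_zero_add]
  simp only [Nat.cast_zero, zero_mul, mul_zero, zero_add]
  refine tsum_congr fun n => ?_
  rw [derivCoeff]; push_cast; ring

lemma UnitSummable.contDiffOn (k : ℕ) : ∀ {a : ℕ → ℝ}, UnitSummable a →
    ContDiffOn ℝ k (fun z => ∑' n, a n * z ^ n) (Set.Ioo (-1) 1) := by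
  induction k with
  | zero =>
    intro a ha
    exact contDiffOn_zero.mpr fun z hz => (ha.hasDerivAt hz).continuousAt.continuousWithinAt
  | succ k ih =>
    intro a ha
    push_cast
    rw [contDiffOn_succ_iff_deriv_of_isOpen isOpen_Ioo]
    refine ⟨fun z hz => (ha.hasDerivAt hz).differentiableAt.differentiableWithinAt, by simp, ?_⟩
    exact (ih ha.derived).congr fun z hz => (ha.hasDerivAt hz).deriv

lemma hasSum_mul_left_shift {b : ℕ → ℝ} (h0 : b 0 = 0) {z A : ℝ}
    (h : HasSum (fun n => b (n + 1) * z ^ n) A) : HasSum (fun n => b n * z ^ n) (z * A) := by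
  rw [← hasSum_nat_add_iff' 1]
  simp only [Finset.range_one, Finset.sum_singleton, h0, zero_mul, sub_zero]
  refine (h.mul_left z).congr_fun fun n => ?_
  ring

/-! ### A hypergeometric series -/

/-- The coefficients of the hypergeometric series with parameters `b, c; 3`. -/
noncomputable def hyperCoeff (b c : ℝ) : ℕ → ℝ
  | 0 => 1
  | n + 1 => hyperCoeff b c n * ((n + b) * (n + c) / ((n + 1) * (n + 3)))

section
variable {b c : ℝ}

lemma hyperCoeff_pos (hb : 0 < b) (hc : 0 < c) (n : ℕ) : 0 < hyperCoeff b c n := by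
  induction n with
  | zero => simp [hyperCoeff]
  | succ n ih => rw [hyperCoeff]; positivity

lemma unitSummable_hyperCoeff (hb : 0 < b) (hc : 0 < c) : UnitSummable (hyperCoeff b c) := by
  intro r hr0 hr1
  rcases hr0.eq_or_lt with rfl | hr
  · exact summable_of_ne_finset_zero (s := {0}) fun n hn => by
      simp [zero_pow (Finset.notMem_singleton.mp hn)]
  refine summable_of_ratio_test_tendsto_lt_one hr1
    (Eventually.of_forall fun n => ?_) ?_
  · have := hyperCoeff_pos hb hc n
    positivity
  · have h1 := tendsto_add_mul_div_add_mul_atTop_nhds b 1 1 (one_ne_zero (α := ℝ))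
    have h2 := tendsto_add_mul_div_add_mul_atTop_nhds c 3 1 (one_ne_zero (α := ℝ))
    have h3 := (h1.mul h2).mul_const r
    simp only [div_one, one_mul] at h3
    refine h3.congr fun n => ?_
    have hp := hyperCoeff_pos hb hc n
    have hp' := hyperCoeff_pos hb hc (n + 1)
    rw [Real.norm_of_nonneg (by positivity), Real.norm_of_nonneg (by positivity),
      abs_of_pos hp, abs_of_pos hp', hyperCoeff]
    field_simp
    ring

/-- The hypergeometric function with parameters `b, c; 3`. -/
noncomputable def hyperFun (b c z : ℝ) : ℝ := ∑' n, hyperCoeff b c n * z ^ n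

/-- The derivative of `hyperFun`. -/
noncomputable def hyperFun' (b c z : ℝ) : ℝ := ∑' n, derivCoeff (hyperCoeff b c) n * z ^ n

/-- The second derivative of `hyperFun`. -/
noncomputable def hyperFun'' (b c z : ℝ) : ℝ :=
  ∑' n, derivCoeff (derivCoeff (hyperCoeff b c)) n * z ^ n

lemma hyperFun_pos (hb : 0 < b) (hc : 0 < c) {z : ℝ} (h0 : 0 ≤ z) (h1 : z < 1) :
    0 < hyperFun b c z := by
  refine ((unitSummable_hyperCoeff hb hc).summable ⟨by linarith, h1⟩).tsum_pos
    (fun n => mul_nonneg (hyperCoeff_pos hb hc n).le (pow_nonneg h0 n)) 0 ?_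
  simp [hyperCoeff]

/-- Comparing coefficients of zⁿ gives exactly the recurrence (n+1)(n+3)hₙ₊₁ = (n+b)(n+c)hₙ. -/
lemma hyperFun_ode (hb : 0 < b) (hc : 0 < c) {z : ℝ} (hz : z ∈ Set.Ioo (-1 : ℝ) 1) :
    z * (1 - z) * hyperFun'' b c z + (3 - (b + c + 1) * z) * hyperFun' b c z
      - b * c * hyperFun b c z = 0 := by
  have hu := unitSummable_hyperCoeff hb hc
  set h := hyperCoeff b c with hh
  have s0 : HasSum (fun n => h n * z ^ n) (hyperFun b c z) := (hu.summable hz).hasSum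
  have s1 : HasSum (fun n => derivCoeff h n * z ^ n) (hyperFun' b c z) :=
    (hu.derived.summable hz).hasSum
  have s2 : HasSum (fun n => derivCoeff (derivCoeff h) n * z ^ n) (hyperFun'' b c z) :=
    (hu.derived.derived.summable hz).hasSum
  have t1 : HasSum (fun n : ℕ => (n * h n) * z ^ n) (z * hyperFun' b c z) :=
    hasSum_mul_left_shift (b := fun n => n * h n) (by simp)
      (s1.congr_fun fun n => by simp [derivCoeff])
  have t2 : HasSum (fun n : ℕ => (n * (n + 1) * h (n + 1)) * z ^ n) (z * hyperFun'' b c z) :=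
    hasSum_mul_left_shift (b := fun n => n * (n + 1) * h (n + 1)) (by simp)
      (s2.congr_fun fun n => by simp only [derivCoeff]; push_cast; ring)
  have t3 : HasSum (fun n : ℕ => (n * (n - 1) * h n) * z ^ n) (z * (z * hyperFun'' b c z)) :=
    hasSum_mul_left_shift (b := fun n => n * (n - 1) * h n) (by simp)
      (t2.congr_fun fun n => by push_cast; ring)
  have := (((t2.sub t3).add (s1.mul_left 3)).sub (t1.mul_left (b + c + 1))).sub
    (s0.mul_left (b * c))
  have hz0 : (fun n : ℕ => (n * (n + 1) * h (n + 1)) * z ^ n - (n * (n - 1) * h n) * z ^ n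
      + 3 * (derivCoeff h n * z ^ n) - (b + c + 1) * ((n * h n) * z ^ n)
      - b * c * (h n * z ^ n)) = fun _ => (0 : ℝ) := by
    funext n
    have : h (n + 1) * ((n + 1) * (n + 3)) = h n * ((n + b) * (n + c)) := by
      rw [hh, hyperCoeff]; field_simp
    rw [derivCoeff]
    linear_combination z ^ n * this
  rw [hz0] at this
  have := this.unique hasSum_zero
  linear_combination this

end

/-! ### The radial profile -/

/-- `(p² - q²) G(p² + q²)` solves the hodograph equation with parameters `τ`, `κ`, and `G` is
positive. -/
structure IsProfile (τ κ : ℝ) (G : ℝ → ℝ) : Prop where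
  contDiffAt : ∀ s, 0 ≤ s → ContDiffAt ℝ 2 G s
  pos : ∀ s, 0 ≤ s → 0 < G s
  ode : ∀ s, 0 ≤ s → 2 * s * (1 + τ * s) * deriv (deriv G) s
    + (6 + (5 * τ + κ) * s) * deriv G s - (κ - τ) * G s = 0

lemma isProfile_zero {κ : ℝ} (hκ : 0 < κ) : IsProfile 0 κ fun s => 6 + κ * s where
  contDiffAt s _ := by fun_prop
  pos s hs := by positivity
  ode s _ := by
    have : deriv (fun s : ℝ => 6 + κ * s) = fun _ => κ := by
      funext s
      simp
    rw [this]
    simp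
    ring

/-- For τ = 1 the substitution z = -s turns the ODE into the hypergeometric equation with parameters
a, b; 3. Its series in -s converges only for s < 1, so Pfaff's transformation is used: G(s) =
(1+s)^(-b) ₂F₁(b, 3-a; 3; s/(1+s)). For s ≥ 0 the argument lies in [0,1), and since b and 3 - a are
positive, all coefficients are positive and so is G. -/
lemma exists_isProfile_one {κ : ℝ} (hκ : 0 < κ) : ∃ G, IsProfile 1 κ G := by
  -- The sum and product are read off from half the ODE, s(1+s)G'' + (3 + (a+b+1)s)G' + abG = 0. The
  -- smaller root is taken as a, so that a ≤ 1/2.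
  obtain ⟨a, b, hb, ha, hsum, hprod⟩ : ∃ a b : ℝ, 0 < b ∧ 0 < 3 - a ∧ a + b = (3 + κ) / 2 ∧
      a * b = (1 - κ) / 2 := by
    have h0 : 0 ≤ κ ^ 2 + 14 * κ + 1 := by positivity
    have h1 : κ + 1 ≤ √(κ ^ 2 + 14 * κ + 1) := Real.le_sqrt_of_sq_le (by nlinarith)
    refine ⟨(3 + κ - √(κ ^ 2 + 14 * κ + 1)) / 4, (3 + κ + √(κ ^ 2 + 14 * κ + 1)) / 4,
      by positivity, by linarith, by ring, ?_⟩
    linear_combination (-1 / 16) * Real.sq_sqrt h0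
  set H := hyperFun b (3 - a)
  set H1 := hyperFun' b (3 - a)
  set H2 := hyperFun'' b (3 - a)
  have hu := unitSummable_hyperCoeff hb ha
  -- An open neighbourhood of [0,∞), so that derivatives at s = 0 are two-sided; the left end -1/2
  -- is where s/(1+s) reaches -1.
  let I : Set ℝ := Set.Ioi (-1 / 2)
  have hI : IsOpen I := isOpen_Ioi
  have hI0 : ∀ s, 0 ≤ s → s ∈ I := fun s hs => by
    change (-1 / 2 : ℝ) < s
    linarith
  have hIpos : ∀ s ∈ I, 0 < 1 + s := fun s hs => by
    have : (-1 / 2 : ℝ) < s := hs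
    linarith
  have hz : ∀ s ∈ I, 1 - (1 + s)⁻¹ ∈ Set.Ioo (-1 : ℝ) 1 := fun s hs => by
    have h1 := hIpos s hs
    have h2 : (-1 / 2 : ℝ) < s := hs
    have h3 : (1 + s)⁻¹ < 2 := by rw [inv_lt_comm₀ h1 two_pos]; linarith
    have h4 : 0 < (1 + s)⁻¹ := by positivity
    exact ⟨by linarith, by linarith⟩
  have dz : ∀ s ∈ I, HasDerivAt (fun s : ℝ => 1 - (1 + s)⁻¹) ((1 + s)⁻¹ ^ 2) s := fun s hs => by
    have := (((hasDerivAt_id s).const_add 1).inv (hIpos s hs).ne').const_sub 1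
    refine this.congr_deriv ?_
    simp only [id]
    field_simp
  have dr : ∀ s ∈ I, HasDerivAt (fun s : ℝ => (1 + s)⁻¹) (-(1 + s)⁻¹ ^ 2) s := fun s hs => by
    refine (((hasDerivAt_id s).const_add 1).inv (hIpos s hs).ne').congr_deriv ?_
    simp only [id]
    field_simp
  have dE : ∀ s ∈ I, HasDerivAt (fun s : ℝ => (1 + s) ^ (-b))
      (-b * (1 + s)⁻¹ * (1 + s) ^ (-b)) s := fun s hs => by
    have := ((hasDerivAt_id s).const_add 1).rpow_const (p := -b) (Or.inl (hIpos s hs).ne')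
    refine this.congr_deriv ?_
    simp only [id]
    rw [Real.rpow_sub_one (hIpos s hs).ne']
    ring
  have dH : ∀ s ∈ I, HasDerivAt (fun s : ℝ => H (1 - (1 + s)⁻¹))
      (H1 (1 - (1 + s)⁻¹) * (1 + s)⁻¹ ^ 2) s := fun s hs => by
    have h : HasDerivAt H (H1 _) _ := hu.hasDerivAt (hz s hs)
    exact h.comp s (dz s hs)
  have dH1 : ∀ s ∈ I, HasDerivAt (fun s : ℝ => H1 (1 - (1 + s)⁻¹))
      (H2 (1 - (1 + s)⁻¹) * (1 + s)⁻¹ ^ 2) s := fun s hs => by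
    have h : HasDerivAt H1 (H2 _) _ := hu.derived.hasDerivAt (hz s hs)
    exact h.comp s (dz s hs)
  let G : ℝ → ℝ := fun s => (1 + s) ^ (-b) * H (1 - (1 + s)⁻¹)
  let G1 : ℝ → ℝ := fun s => (1 + s) ^ (-b) * (-b * (1 + s)⁻¹ * H (1 - (1 + s)⁻¹)
    + (1 + s)⁻¹ ^ 2 * H1 (1 - (1 + s)⁻¹))
  have dG : ∀ s ∈ I, HasDerivAt G (G1 s) s := fun s hs =>
    ((dE s hs).mul (dH s hs)).congr_deriv (by simp only [G1]; ring)
  have dG1 : ∀ s ∈ I, HasDerivAt G1 ((1 + s) ^ (-b) *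
      (b * (b + 1) * (1 + s)⁻¹ ^ 2 * H (1 - (1 + s)⁻¹)
        - (2 * b + 2) * (1 + s)⁻¹ ^ 3 * H1 (1 - (1 + s)⁻¹)
        + (1 + s)⁻¹ ^ 4 * H2 (1 - (1 + s)⁻¹))) s := fun s hs =>
    ((dE s hs).mul ((((dr s hs).const_mul (-b)).mul (dH s hs)).add
      (((dr s hs).pow 2).mul (dH1 s hs)))).congr_deriv (by
        simp only [Pi.add_apply, Pi.mul_apply, Pi.pow_apply]
        push_cast
        ring)
  have derivG : ∀ s ∈ I, deriv G s = G1 s := fun s hs => (dG s hs).deriv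
  have derivG1 : ∀ s ∈ I, deriv (deriv G) s = _ := fun s hs =>
    (Filter.EventuallyEq.deriv_eq (eventually_of_mem (hI.mem_nhds hs) derivG)).trans
      (dG1 s hs).deriv
  refine ⟨G, fun s hs => ?_, fun s hs => ?_, fun s hs => ?_⟩
  · have hs' := hI0 s hs
    have h1 : ContDiffAt ℝ 2 (fun s : ℝ => (1 + s) ^ (-b)) s :=
      ContDiffAt.rpow_const_of_ne (by fun_prop) (hIpos s hs').ne'
    have h2 : ContDiffAt ℝ 2 (fun s : ℝ => 1 - (1 + s)⁻¹) s :=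
      contDiffAt_const.sub (ContDiffAt.inv (by fun_prop) (hIpos s hs').ne')
    have h3 : ContDiffAt ℝ 2 H (1 - (1 + s)⁻¹) :=
      (hu.contDiffOn 2).contDiffAt (isOpen_Ioo.mem_nhds (hz s hs'))
    exact h1.mul (ContDiffAt.comp (g := H) s h3 h2)
  · have h1 := hIpos s (hI0 s hs)
    refine mul_pos (by positivity) (hyperFun_pos hb ha ?_ (hz s (hI0 s hs)).2)
    have : (1 + s)⁻¹ ≤ 1 := inv_le_one_of_one_le₀ (by linarith)
    linarith
  · have hs' := hI0 s hs
    have h1 := (hIpos s hs').ne'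
    have hode := hyperFun_ode hb ha (hz s hs')
    change _ * H2 _ + _ * H1 _ - _ * H _ = 0 at hode
    rw [derivG1 s hs', derivG s hs']
    simp only [G, G1]
    obtain ⟨r, hr⟩ : ∃ r, r = (1 + s)⁻¹ := ⟨_, rfl⟩
    have hr0 : r ≠ 0 := by rw [hr]; positivity
    have hsr : s = 1 / r - 1 := by rw [hr]; field_simp; ring
    rw [← hr] at hode ⊢
    generalize H (1 - r) = y0 at *
    generalize H1 (1 - r) = y1 at *
    generalize H2 (1 - r) = y2 at *
    generalize (1 + s) ^ (-b) = E at *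
    have key : s * (1 + s) * (b * (b + 1) * r ^ 2 * y0 - (2 * b + 2) * r ^ 3 * y1 + r ^ 4 * y2)
        + (3 + (a + b + 1) * s) * (-b * r * y0 + r ^ 2 * y1) + a * b * y0 = 0 := by
      rw [← mul_zero r, ← hode, hsr]
      field_simp
      ring
    linear_combination 2 * E * key - 2 * E * s * (-b * r * y0 + r ^ 2 * y1) * hsum
      - 2 * E * y0 * hprod

/-- The scaling s ↦ τs reduces τ > 0 to τ = 1 with κ/τ in place of κ. -/
lemma exists_isProfile {τ κ : ℝ} (hτ : 0 ≤ τ) (hκ : 0 < κ) : ∃ G, IsProfile τ κ G := by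
  rcases hτ.eq_or_lt with rfl | hτ
  · exact ⟨_, isProfile_zero hκ⟩
  obtain ⟨G, hG⟩ := exists_isProfile_one (div_pos hκ hτ)
  have hd : deriv (fun s => G (τ * s)) = fun s => τ * deriv G (τ * s) := by
    funext s
    simpa using deriv_comp_mul_left τ G s
  have hdd : deriv (fun s => τ * deriv G (τ * s)) = fun s => τ * (τ * deriv (deriv G) (τ * s)) := by
    funext s
    rw [deriv_const_mul_field]
    congr 1
    simpa using deriv_comp_mul_left τ (deriv G) s
  refine ⟨fun s => G (τ * s), fun s hs => ?_, fun s hs => hG.pos _ (by positivity), fun s hs => ?_⟩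
  · exact (hG.contDiffAt (τ * s) (by positivity)).comp s (by fun_prop)
  · have := hG.ode (τ * s) (by positivity)
    rw [hd, hdd]
    have h2 : κ / τ * τ = κ := by field_simp
    linear_combination τ * this - (s * τ * deriv G (τ * s) - G (τ * s)) * h2

/-- A function that is positive at `0` and increases wherever it vanishes stays positive. -/
lemma pos_of_deriv_pos_of_eq_zero {f f' : ℝ → ℝ} (h0 : 0 < f 0)
    (hf : ∀ s, 0 ≤ s → HasDerivAt f (f' s) s) (h : ∀ s, 0 < s → f s = 0 → 0 < f' s) {s : ℝ}
    (hs : 0 ≤ s) : 0 < f s := by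
  have hnn : ∀ t, 0 ≤ t → 0 ≤ f t := by
    intro t ht
    have := image_le_of_deriv_right_lt_deriv_boundary (f := fun x => -f x) (f' := fun x => -f' x)
      (a := 0) (b := t) (B := fun _ => 0) (B' := fun _ => 0)
      (fun x hx => (hf x hx.1).neg.continuousAt.continuousWithinAt)
      (fun x hx => (hf x hx.1).neg.hasDerivWithinAt) (by linarith)
      (fun x => hasDerivAt_const x 0)
      (fun x hx hx0 => by
        have hfx : f x = 0 := by simpa using hx0
        have : 0 < x := lt_of_le_of_ne hx.1 fun e => by rw [← e] at hfx; linarith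
        simpa using h x this hfx) (Set.right_mem_Icc.mpr ht)
    linarith
  refine lt_of_le_of_ne (hnn s hs) fun e => ?_
  have hs0 : 0 < s := lt_of_le_of_ne hs fun e' => by rw [← e'] at e; linarith
  -- A zero at s > 0 would be a local minimum of the nonnegative f, where the derivative vanishes
  -- instead of being positive.
  have hmin : IsLocalMin f s := by
    filter_upwards [lt_mem_nhds hs0] with t ht
    rw [← e]; exact hnn t ht.le
  have := hmin.hasDerivAt_eq_zero (hf s hs)
  linarith [h s hs0 e.symm]

/-! ### Barrier estimates and growth for profiles -/

section
variable {τ κ : ℝ} {G : ℝ → ℝ}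

lemma IsProfile.hasDerivAt (hG : IsProfile τ κ G) {s : ℝ} (hs : 0 ≤ s) :
    HasDerivAt G (deriv G s) s :=
  ((hG.contDiffAt s hs).differentiableAt (by norm_num)).hasDerivAt

lemma IsProfile.contDiffAt_deriv (hG : IsProfile τ κ G) {s : ℝ} (hs : 0 ≤ s) :
    ContDiffAt ℝ 1 (deriv G) s :=
  ((hG.contDiffAt s hs).fderiv_right (m := 1) (by norm_num)).clm_apply contDiffAt_const

lemma IsProfile.hasDerivAt_deriv (hG : IsProfile τ κ G) {s : ℝ} (hs : 0 ≤ s) :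
    HasDerivAt (deriv G) (deriv (deriv G) s) s :=
  ((hG.contDiffAt_deriv hs).differentiableAt (by norm_num)).hasDerivAt

/-- Where Z = G - sG' vanishes, substituting sG' = G in the ODE gives sZ' = 3G > 0, so Z cannot
cross zero. -/
lemma IsProfile.sub_pos (hG : IsProfile τ κ G) (hτ : 0 ≤ τ) {s : ℝ} (hs : 0 ≤ s) :
    0 < G s - s * deriv G s := by
  refine pos_of_deriv_pos_of_eq_zero (f := fun s => G s - s * deriv G s)
    (f' := fun s => - (s * deriv (deriv G) s)) ?_ (fun s hs => ?_) (fun s hs h0 => ?_) hs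
  · simpa using hG.pos 0 le_rfl
  · refine ((hG.hasDerivAt hs).sub
      ((hasDerivAt_id s).mul (hG.hasDerivAt_deriv hs))).congr_deriv ?_
    simp
  · have h1 := hG.ode s hs.le
    have h2 := hG.pos s hs.le
    have h3 : - (s * deriv (deriv G) s) * (s * (1 + τ * s)) = 3 * (1 + τ * s) * G s := by
      linear_combination (-s / 2) * h1 - (6 + (5 * τ + κ) * s) / 2 * h0
    have h4 : 0 < s * (1 + τ * s) := by positivity
    have h5 : 0 < 3 * (1 + τ * s) * G s := by positivity
    rw [← h3] at h5
    exact pos_of_mul_pos_left h5 h4.le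

/-- The exponent of a lower growth bound for profiles. -/
noncomputable def growthExponent (τ κ : ℝ) : ℝ := 1 / 2 - κ / (4 * (τ + κ))

lemma growthExponent_bounds (hτ : 0 ≤ τ) (hκ : 0 < κ) :
    1 / 4 ≤ growthExponent τ κ ∧ growthExponent τ κ < 1 / 2 := by
  have h1 : 0 < κ / (4 * (τ + κ)) := by positivity
  have h2 : κ / (4 * (τ + κ)) ≤ 1 / 4 := by
    rw [div_le_iff₀ (by positivity)]; linarith
  unfold growthExponent
  constructor <;> linarith

/-- The same barrier argument with sG' = -βG. Positivity of the derivative at a zero comes down to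
`hβ3`, whose expression equals 3κ/4 at β = 1/2; hence β may be taken slightly smaller than 1/2. -/
lemma IsProfile.add_pos (hG : IsProfile τ κ G) (hτ : 0 ≤ τ) (hκ : 0 < κ) {s : ℝ} (hs : 0 ≤ s) :
    0 < s * deriv G s + growthExponent τ κ * G s := by
  obtain ⟨hβ1, hβ2⟩ := growthExponent_bounds hτ hκ
  have hβ3 : 0 < (κ - τ) / 2 + growthExponent τ κ * (3 * τ + κ) / 2
      - τ * growthExponent τ κ ^ 2 := by
    obtain ⟨d, hd⟩ : ∃ d, d = κ / (4 * (τ + κ)) := ⟨_, rfl⟩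
    have hd0 : 0 < d := by rw [hd]; positivity
    have hd1 : d ≤ 1 / 4 := by rw [hd, div_le_iff₀ (by positivity)]; linarith
    have hd2 : d * (τ + κ) = κ / 4 := by rw [hd]; field_simp
    rw [growthExponent, ← hd]
    have : 0 < d * κ := by positivity
    have : 0 ≤ d * τ := by positivity
    nlinarith [mul_le_mul_of_nonneg_left hd1 (by positivity : 0 ≤ d * τ)]
  generalize growthExponent τ κ = β at *
  refine pos_of_deriv_pos_of_eq_zero (f := fun s => s * deriv G s + β * G s)
    (f' := fun s => deriv G s + s * deriv (deriv G) s + β * deriv G s)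
    ?_ (fun s hs => ?_) (fun s hs h0 => ?_) hs
  · have := hG.pos 0 le_rfl
    simp only [zero_mul, zero_add]
    positivity
  · refine (((hasDerivAt_id s).mul (hG.hasDerivAt_deriv hs)).add
      ((hG.hasDerivAt hs).const_mul β)).congr_deriv ?_
    simp
  · have h1 := hG.ode s hs.le
    have h2 := hG.pos s hs.le
    have h3 : (deriv G s + s * deriv (deriv G) s + β * deriv G s) * (s * (1 + τ * s)) =
        (β * (2 - β) + s * ((κ - τ) / 2 + β * (3 * τ + κ) / 2 - τ * β ^ 2)) * G s := by
      linear_combination (s / 2) * h1 + ((1 + β) * (1 + τ * s) - (6 + (5 * τ + κ) * s) / 2) * h0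
    have h4 : 0 < s * (1 + τ * s) := by positivity
    have h5 : 0 < (β * (2 - β) + s * ((κ - τ) / 2 + β * (3 * τ + κ) / 2 - τ * β ^ 2)) * G s := by
      have : 0 < 2 - β := by linarith
      have : 0 < β := by linarith
      positivity
    rw [← h3] at h5
    exact pos_of_mul_pos_left h5 h4.le

lemma IsProfile.growth (hG : IsProfile τ κ G) (hτ : 0 ≤ τ) (hκ : 0 < κ) {s : ℝ} (hs : 1 ≤ s) :
    G 1 ≤ s ^ growthExponent τ κ * G s := by
  have hd : ∀ s : ℝ, 1 ≤ s → HasDerivAt (fun s => s ^ growthExponent τ κ * G s)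
      (s ^ growthExponent τ κ / s * (s * deriv G s + growthExponent τ κ * G s)) s := by
    intro s hs
    have h0 : s ≠ 0 := by linarith
    refine ((Real.hasDerivAt_rpow_const (Or.inl h0)).mul
      (hG.hasDerivAt (by linarith))).congr_deriv ?_
    rw [Real.rpow_sub_one h0]
    field_simp
    ring
  have hmono : MonotoneOn (fun s => s ^ growthExponent τ κ * G s) (Set.Ici 1) := by
    refine monotoneOn_of_deriv_nonneg (convex_Ici 1)
      (fun s hs => (hd s hs).continuousAt.continuousWithinAt)
      (fun s hs => (hd s (interior_subset hs)).differentiableAt.differentiableWithinAt)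
      (fun s hs => ?_)
    have hs1 : 1 ≤ s := interior_subset hs
    rw [(hd s hs1).deriv]
    have := hG.add_pos hτ hκ (by linarith : 0 ≤ s)
    positivity
  simpa using hmono (Set.self_mem_Ici) (Set.mem_Ici.mpr hs) hs

/-- Since s^β G is nondecreasing on [1,∞), sG² ≥ G(1)² s^(1-2β) there, and 1 - 2β > 0. -/
lemma IsProfile.tendsto (hG : IsProfile τ κ G) (hτ : 0 ≤ τ) (hκ : 0 < κ) :
    Tendsto (fun s => s * G s ^ 2) atTop atTop := by
  obtain ⟨-, hβ⟩ := growthExponent_bounds hτ hκ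
  have h1 := hG.pos 1 zero_le_one
  have hlim : Tendsto (fun s : ℝ => G 1 ^ 2 * s ^ (1 - 2 * growthExponent τ κ)) atTop atTop :=
    (tendsto_rpow_atTop (by linarith)).const_mul_atTop (by positivity)
  refine tendsto_atTop_mono' _ ?_ hlim
  filter_upwards [eventually_ge_atTop 1] with s hs
  have hs0 : 0 < s := by linarith
  have h2 := hG.growth hτ hκ hs
  rw [Real.rpow_sub hs0, Real.rpow_one, mul_comm 2, Real.rpow_mul hs0.le, Real.rpow_two,
    mul_div_assoc', div_le_iff₀ (by positivity)]
  calc G 1 ^ 2 * s ≤ (s ^ growthExponent τ κ * G s) ^ 2 * s := by gcongr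
    _ = _ := by ring

end

/-! ### Global inversion -/

/-- A closed local homeomorphism to a connected space is bijective as soon as one fibre is a
singleton. -/
theorem bijective_of_isLocalHomeomorph_of_isClosedMap {X Y : Type*} [TopologicalSpace X]
    [TopologicalSpace Y] [T2Space X] [PreconnectedSpace Y] {f : X → Y}
    (hf : IsLocalHomeomorph f) (hc : IsClosedMap f) (x₀ : X) (h₀ : ∀ x, f x = f x₀ → x = x₀) :
    Function.Bijective f := by
  have hsurj : Function.Surjective f := by
    have : IsClopen (Set.range f) := ⟨hc.isClosed_range, hf.isOpenMap.isOpen_range⟩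
    exact Set.range_eq_univ.mp (this.eq_univ ⟨f x₀, x₀, rfl⟩)
  refine ⟨?_, hsurj⟩
  let A : Set Y := {y | ∀ x x', f x = y → f x' = y → x = x'}
  -- Values near y are not attained off a chart around its only preimage, because the closed map
  -- sends the complement of that chart to a closed set missing y.
  have hopen : IsOpen A := by
    rw [isOpen_iff_mem_nhds]
    intro y hy
    obtain ⟨x, rfl⟩ := hsurj y
    obtain ⟨e, hx, rfl⟩ := hf x
    have hcl : IsClosed (e '' e.sourceᶜ) := hc _ e.open_source.isClosed_compl
    refine mem_of_superset (hcl.isOpen_compl.mem_nhds ?_) ?_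
    · rintro ⟨x', hx', he⟩
      exact hx' (hy x' x he rfl ▸ hx)
    · intro y' hy' x1 x2 h1 h2
      have hmem : ∀ x, e x = y' → x ∈ e.source := fun x hx => by
        by_contra hn
        exact hy' ⟨x, hn, hx⟩
      exact e.injOn (hmem x1 h1) (hmem x2 h2) (h1.trans h2.symm)
  -- Two distinct preimages have disjoint neighbourhoods, whose images both cover a neighbourhood of
  -- y.
  have hclosed : IsClosed A := by
    rw [← isOpen_compl_iff, isOpen_iff_mem_nhds]
    intro y hy
    obtain ⟨x, x', hx, hx', hne⟩ : ∃ x x', f x = y ∧ f x' = y ∧ x ≠ x' := by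
      have : ¬ ∀ x x', f x = y → f x' = y → x = x' := hy
      push Not at this
      exact this
    obtain ⟨U, U', hU, hU', hxU, hxU', hd⟩ := t2_separation hne
    have h1 : f '' U ∈ 𝓝 y := hx ▸ (hf.isOpenMap U hU).mem_nhds ⟨x, hxU, rfl⟩
    have h2 : f '' U' ∈ 𝓝 y := hx' ▸ (hf.isOpenMap U' hU').mem_nhds ⟨x', hxU', rfl⟩
    filter_upwards [h1, h2]
    rintro _ ⟨a, ha, rfl⟩ ⟨b, hb, hab⟩ hA
    have : b = a := hA b a hab rfl
    exact Set.disjoint_left.mp hd ha (this ▸ hb)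
  have hA : A = Set.univ := IsClopen.eq_univ ⟨hclosed, hopen⟩
    ⟨f x₀, fun x x' h h' => (h₀ x h).trans (h₀ x' h').symm⟩
  intro x x' h
  have : f x' ∈ A := hA ▸ Set.mem_univ _
  exact this x x' h rfl

/-- A global inverse function theorem: a proper local diffeomorphism with a singleton fibre is a
diffeomorphism. -/
theorem exists_contDiff_inverse {E : Type*} [NormedAddCommGroup E] [NormedSpace ℝ E]
    [FiniteDimensional ℝ E] {T : E → E} {T' : E → E ≃L[ℝ] E} (hT : ContDiff ℝ 1 T)
    (hT' : ∀ x, HasFDerivAt T (T' x : E →L[ℝ] E) x)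
    (hp : Tendsto T (cocompact E) (cocompact E)) (x₀ : E) (h₀ : ∀ x, T x = T x₀ → x = x₀) :
    ∃ S : E → E, ContDiff ℝ 1 S ∧ (∀ x, T (S x) = x) ∧ ∀ x, S (T x) = x := by
  have : CompleteSpace E := FiniteDimensional.complete ℝ E
  have : ProperSpace E := FiniteDimensional.proper ℝ E
  have hloc : IsLocalHomeomorph T := IsLocalHomeomorph.mk T fun x =>
    ⟨hT.contDiffAt.toOpenPartialHomeomorph T (hT' x) one_ne_zero,
      hT.contDiffAt.mem_toOpenPartialHomeomorph_source (hT' x) one_ne_zero, fun _ _ => rfl⟩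
  have hprop : IsProperMap T := isProperMap_iff_tendsto_cocompact.mpr ⟨hT.continuous, hp⟩
  have hbij := bijective_of_isLocalHomeomorph_of_isClosedMap hloc hprop.isClosedMap x₀ h₀
  let e : E ≃ₜ E := hloc.toHomeomorphOfBijective hbij
  exact ⟨e.symm, e.contDiff_symm hT' hT, e.apply_symm_apply, e.symm_apply_apply⟩

/-- The linear automorphism of the plane with symmetric matrix `(a, b; b, d)`. -/
noncomputable def symmEquiv (a b d : ℝ) (h : a * d - b ^ 2 ≠ 0) : (ℝ × ℝ) ≃L[ℝ] (ℝ × ℝ) :=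
  ContinuousLinearEquiv.equivOfInverse
    ((a • ContinuousLinearMap.fst ℝ ℝ ℝ + b • ContinuousLinearMap.snd ℝ ℝ ℝ).prod
      (b • ContinuousLinearMap.fst ℝ ℝ ℝ + d • ContinuousLinearMap.snd ℝ ℝ ℝ))
    (((d / (a * d - b ^ 2)) • ContinuousLinearMap.fst ℝ ℝ ℝ
        - (b / (a * d - b ^ 2)) • ContinuousLinearMap.snd ℝ ℝ ℝ).prod
      ((a / (a * d - b ^ 2)) • ContinuousLinearMap.snd ℝ ℝ ℝ
        - (b / (a * d - b ^ 2)) • ContinuousLinearMap.fst ℝ ℝ ℝ))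
    (fun v => by
      have hk := mul_inv_cancel₀ h
      ext
      · simp [div_eq_mul_inv]
        linear_combination v.1 * hk
      · simp [div_eq_mul_inv]
        linear_combination v.2 * hk)
    (fun v => by
      have hk := mul_inv_cancel₀ h
      ext
      · simp [div_eq_mul_inv]
        linear_combination v.1 * hk
      · simp [div_eq_mul_inv]
        linear_combination v.2 * hk)

/-! ### The Legendre transform -/

lemma fderiv_grad_apply {U : ℝ × ℝ → ℝ} (hU : ContDiff ℝ 2 U) (z v : ℝ × ℝ) :
    fderiv ℝ (grad U) z v =
      (partialX (partialX U) z * v.1 + partialY (partialX U) z * v.2,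
        partialY (partialX U) z * v.1 + partialY (partialY U) z * v.2) := by
  have h1 : DifferentiableAt ℝ (partialX U) z :=
    (contDiff_partialX (m := 1) hU (by norm_num)).differentiable (by norm_num) z
  have h2 : DifferentiableAt ℝ (partialY U) z :=
    (contDiff_partialY (m := 1) hU (by norm_num)).differentiable (by norm_num) z
  have : fderiv ℝ (grad U) z = (fderiv ℝ (partialX U) z).prod (fderiv ℝ (partialY U) z) :=
    h1.fderiv_prodMk h2
  rw [this, ContinuousLinearMap.prod_apply, fderiv_apply_eq, fderiv_apply_eq,
    partialX_partialY_comm hU]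
  ext <;> simp only <;> ring

/-- If the gradient of a solution `U` of the hodograph equation is a proper local diffeomorphism of
the plane with a singleton fibre, then the Legendre transform of `U` is an entire solution of
`L[u] = 0` that is not affine linear. -/
theorem exists_entire_solution_of_hodograph {γ ε : ℝ} {U : ℝ × ℝ → ℝ} (hU : ContDiff ℝ 2 U)
    (heq : ∀ z, coeffXX γ ε z * partialY (partialY U) z
      - 2 * coeffXY z * partialY (partialX U) z + coeffYY γ ε z * partialX (partialX U) z = 0)
    (hdet : ∀ z, partialX (partialX U) z * partialY (partialY U) z
      - partialY (partialX U) z ^ 2 ≠ 0)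
    (hp : Tendsto (grad U) (cocompact (ℝ × ℝ)) (cocompact (ℝ × ℝ)))
    (h₀ : ∀ z, grad U z = grad U 0 → z = 0) :
    ∃ u : ℝ × ℝ → ℝ, IsEntireSolution (L γ ε) u ∧ ¬ IsAffineLinear u := by
  have hT : ContDiff ℝ 1 (grad U) := contDiff_grad hU (by norm_num)
  have hTd : ∀ z, HasFDerivAt (grad U) (fderiv ℝ (grad U) z) z := fun z =>
    (hT.differentiable (by norm_num) z).hasFDerivAt
  obtain ⟨S, hS, hTS, hST⟩ := exists_contDiff_inverse
    (T' := fun z => symmEquiv _ _ _ (hdet z)) hT (fun z => by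
      refine (hTd z).congr_fderiv ?_
      refine ContinuousLinearMap.ext fun v => ?_
      rw [fderiv_grad_apply hU]
      simp [symmEquiv]) hp 0 h₀
  have hSd : ∀ x, HasFDerivAt S (fderiv ℝ S x) x := fun x =>
    (hS.differentiable (by norm_num) x).hasFDerivAt
  have hcomp : ∀ x v, fderiv ℝ (grad U) (S x) (fderiv ℝ S x v) = v := fun x v => by
    have h1 : HasFDerivAt (fun x => grad U (S x)) _ x := (hTd (S x)).comp x (hSd x)
    have h2 : HasFDerivAt (fun x => grad U (S x)) (ContinuousLinearMap.id ℝ (ℝ × ℝ)) x := by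
      simp only [hTS]; exact hasFDerivAt_id x
    exact congrArg (fun A : (ℝ × ℝ) →L[ℝ] (ℝ × ℝ) => A v) (h1.unique h2)
  let u : ℝ × ℝ → ℝ := fun x => (S x).1 * x.1 + (S x).2 * x.2 - U (S x)
  -- The terms containing DS cancel because DU(S(x)) = x, so Du = S; this is also why u is C²
  -- although S is only C¹.
  have hud : ∀ x, HasFDerivAt u ((S x).1 • ContinuousLinearMap.fst ℝ ℝ ℝ
      + (S x).2 • ContinuousLinearMap.snd ℝ ℝ ℝ) x := fun x => by
    have h := ((((hSd x).fst.mul hasFDerivAt_fst).add ((hSd x).snd.mul hasFDerivAt_snd))).sub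
      (((hU.differentiable (by norm_num) (S x)).hasFDerivAt).comp x (hSd x))
    refine h.congr_fderiv ?_
    refine ContinuousLinearMap.ext fun v => ?_
    have hx1 : partialX U (S x) = x.1 := congrArg Prod.fst (hTS x)
    have hx2 : partialY U (S x) = x.2 := congrArg Prod.snd (hTS x)
    simp [fderiv_apply_eq U, hx1, hx2]
    ring
  have hgrad : grad u = S := by
    funext x
    ext <;> simp [grad, partialX, partialY, (hud x).fderiv]
  have hX : partialX u = fun x => (S x).1 := funext fun x => congrArg Prod.fst (congrFun hgrad x)
  have hY : partialY u = fun x => (S x).2 := funext fun x => congrArg Prod.snd (congrFun hgrad x)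
  have hX' : ∀ x v, fderiv ℝ (partialX u) x v = (fderiv ℝ S x v).1 := fun x v => by
    rw [hX, (hSd x).fst.fderiv]; rfl
  have hY' : ∀ x v, fderiv ℝ (partialY u) x v = (fderiv ℝ S x v).2 := fun x v => by
    rw [hY, (hSd x).snd.fderiv]; rfl
  refine ⟨u, ⟨?_, fun x => ?_⟩, ?_⟩
  · rw [show (2 : WithTop ℕ∞) = ((1 : ℕ) : WithTop ℕ∞) + 1 by norm_num, contDiff_succ_iff_hasFDerivAt]
    refine ⟨_, ?_, hud⟩
    exact_mod_cast (hS.fst.smul contDiff_const).add (hS.snd.smul contDiff_const)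
  · have e1 := hcomp x (1, 0)
    have e2 := hcomp x (0, 1)
    rw [fderiv_grad_apply hU, Prod.mk.injEq] at e1 e2
    obtain ⟨e11, e12⟩ := e1
    obtain ⟨e21, e22⟩ := e2
    have hD := hdet (S x)
    have hE := heq (S x)
    rw [L, hgrad]
    change coeffXX γ ε (S x) * fderiv ℝ (partialX u) x (1, 0)
      + 2 * coeffXY (S x) * fderiv ℝ (partialX u) x (0, 1)
      + coeffYY γ ε (S x) * fderiv ℝ (partialY u) x (0, 1) = 0
    rw [hX', hX', hY']
    generalize partialX (partialX U) (S x) = a at *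
    generalize partialY (partialX U) (S x) = b at *
    generalize partialY (partialY U) (S x) = d at *
    -- Cramer's rule: D²u = DS is the inverse of D²U at S(x). Multiplying L[u] by the determinant
    -- therefore gives the hodograph equation.
    have hα : (a * d - b ^ 2) * (fderiv ℝ S x (1, 0)).1 = d := by
      linear_combination d * e11 - b * e12
    have hβ : (a * d - b ^ 2) * (fderiv ℝ S x (0, 1)).1 = -b := by
      linear_combination d * e21 - b * e22
    have hδ : (a * d - b ^ 2) * (fderiv ℝ S x (0, 1)).2 = a := by
      linear_combination a * e22 - b * e21
    refine (mul_eq_zero.mp ?_).resolve_left hD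
    linear_combination coeffXX γ ε (S x) * hα + 2 * coeffXY (S x) * hβ
      + coeffYY γ ε (S x) * hδ + hE
  · rintro ⟨a, b, c, h⟩
    have hconst : ∀ x, S x = (a, b) := fun x => by
      have hux : HasFDerivAt u (a • ContinuousLinearMap.fst ℝ ℝ ℝ
          + b • ContinuousLinearMap.snd ℝ ℝ ℝ) x := by
        rw [show u = fun z => a * z.1 + b * z.2 + c from funext h]
        exact ((hasFDerivAt_fst.const_mul a).add (hasFDerivAt_snd.const_mul b)).add_const c
      rw [← hgrad]
      ext <;> simp [grad, partialX, partialY, hux.fderiv]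
    -- An affine u would have constant gradient, but S is onto; the value (a + 1, b) is attained
    -- too.
    have h1 : S (grad U (a + 1, b)) = (a, b) := hconst _
    rw [hST] at h1
    simpa using congrArg Prod.fst h1

/-! ### The saddle-shaped solution of the hodograph equation -/

/-- The function `(p² - q²) G(p² + q²)`. -/
def saddle (G : ℝ → ℝ) (z : ℝ × ℝ) : ℝ := (z.1 ^ 2 - z.2 ^ 2) * G (z.1 ^ 2 + z.2 ^ 2)

section
variable {τ κ : ℝ} {G : ℝ → ℝ}

lemma IsProfile.contDiff_saddle (hG : IsProfile τ κ G) : ContDiff ℝ 2 (saddle G) := by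
  rw [contDiff_iff_contDiffAt]
  intro z
  have h : ContDiffAt ℝ 2 (fun z : ℝ × ℝ => z.1 ^ 2 + z.2 ^ 2) z := by fun_prop
  have h2 : ContDiffAt ℝ 2 (fun z : ℝ × ℝ => z.1 ^ 2 - z.2 ^ 2) z := by fun_prop
  exact h2.mul ((hG.contDiffAt _ (by positivity)).comp z h)

lemma hasFDerivAt_sq_add_sq (z : ℝ × ℝ) : HasFDerivAt (fun z : ℝ × ℝ => z.1 ^ 2 + z.2 ^ 2)
    ((2 * z.1) • ContinuousLinearMap.fst ℝ ℝ ℝ + (2 * z.2) • ContinuousLinearMap.snd ℝ ℝ ℝ) z :=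
  (((hasFDerivAt_fst (𝕜 := ℝ) (p := z)).pow 2).add
    ((hasFDerivAt_snd (𝕜 := ℝ) (p := z)).pow 2)).congr_fderiv (by simp)

lemma hasFDerivAt_sq_sub_sq (z : ℝ × ℝ) : HasFDerivAt (fun z : ℝ × ℝ => z.1 ^ 2 - z.2 ^ 2)
    ((2 * z.1) • ContinuousLinearMap.fst ℝ ℝ ℝ - (2 * z.2) • ContinuousLinearMap.snd ℝ ℝ ℝ) z :=
  (((hasFDerivAt_fst (𝕜 := ℝ) (p := z)).pow 2).sub
    ((hasFDerivAt_snd (𝕜 := ℝ) (p := z)).pow 2)).congr_fderiv (by simp)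

lemma IsProfile.grad_saddle (hG : IsProfile τ κ G) (z : ℝ × ℝ) :
    partialX (saddle G) z = 2 * z.1 * (G (z.1 ^ 2 + z.2 ^ 2)
      + (z.1 ^ 2 - z.2 ^ 2) * deriv G (z.1 ^ 2 + z.2 ^ 2)) ∧
    partialY (saddle G) z = -2 * z.2 * (G (z.1 ^ 2 + z.2 ^ 2)
      - (z.1 ^ 2 - z.2 ^ 2) * deriv G (z.1 ^ 2 + z.2 ^ 2)) := by
  have := ((hasFDerivAt_sq_sub_sq z).mul ((hG.hasDerivAt (by positivity)).comp_hasFDerivAt z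
    (hasFDerivAt_sq_add_sq z))).fderiv
  have h : fderiv ℝ (saddle G) z = _ := this
  constructor <;> simp [partialX, partialY, h] <;> ring

lemma IsProfile.hessian_saddle (hG : IsProfile τ κ G) (z : ℝ × ℝ) :
    partialX (partialX (saddle G)) z = 2 * G (z.1 ^ 2 + z.2 ^ 2)
      + (10 * z.1 ^ 2 - 2 * z.2 ^ 2) * deriv G (z.1 ^ 2 + z.2 ^ 2)
      + 4 * z.1 ^ 2 * (z.1 ^ 2 - z.2 ^ 2) * deriv (deriv G) (z.1 ^ 2 + z.2 ^ 2) ∧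
    partialY (partialX (saddle G)) z =
      4 * z.1 * z.2 * (z.1 ^ 2 - z.2 ^ 2) * deriv (deriv G) (z.1 ^ 2 + z.2 ^ 2) ∧
    partialY (partialY (saddle G)) z = -2 * G (z.1 ^ 2 + z.2 ^ 2)
      + (2 * z.1 ^ 2 - 10 * z.2 ^ 2) * deriv G (z.1 ^ 2 + z.2 ^ 2)
      + 4 * z.2 ^ 2 * (z.1 ^ 2 - z.2 ^ 2) * deriv (deriv G) (z.1 ^ 2 + z.2 ^ 2) := by
  have d0 := (hG.hasDerivAt (by positivity)).comp_hasFDerivAt z (hasFDerivAt_sq_add_sq z)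
  have d1 := (hasFDerivAt_sq_sub_sq z).mul
    ((hG.hasDerivAt_deriv (by positivity)).comp_hasFDerivAt z (hasFDerivAt_sq_add_sq z))
  have dX := ((hasFDerivAt_fst (𝕜 := ℝ) (p := z)).const_mul 2).mul (d0.add d1)
  have dY := ((hasFDerivAt_snd (𝕜 := ℝ) (p := z)).const_mul (-2)).mul (d0.sub d1)
  have hX : fderiv ℝ (partialX (saddle G)) z = _ :=
    (congrArg (fun f => fderiv ℝ f z) (funext fun z => (hG.grad_saddle z).1)).trans dX.fderiv
  have hY : fderiv ℝ (partialY (saddle G)) z = _ :=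
    (congrArg (fun f => fderiv ℝ f z) (funext fun z => (hG.grad_saddle z).2)).trans dY.fderiv
  refine ⟨?_, ?_, ?_⟩
  · rw [partialX, hX]; simp; ring
  · rw [partialY, hX]; simp; ring
  · rw [partialY, hY]; simp; ring

/-- In polar coordinates U = h(r) cos 2θ with h = r²G(r²). The Hessian entries in the polar frame
are R cos 2θ, -2(G - sG') cos 2θ and, off the diagonal, -2(G + 2sG') sin 2θ, where R = h''. Thus the
determinant is negative once R, G - sG' and G + 2sG' are positive. -/
lemma IsProfile.hessian_det_neg (hG : IsProfile τ κ G) (hτ : 0 ≤ τ) (hκ : 0 < κ) (z : ℝ × ℝ) :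
    partialX (partialX (saddle G)) z * partialY (partialY (saddle G)) z
      - partialY (partialX (saddle G)) z ^ 2 < 0 := by
  obtain ⟨h1, h2, h3⟩ := hG.hessian_saddle z
  rw [h1, h2, h3]
  have hs0 : 0 ≤ z.1 ^ 2 + z.2 ^ 2 := by positivity
  have hpos := hG.pos _ hs0
  rcases hs0.eq_or_lt with h0 | hs
  · have hp : z.1 = 0 := by nlinarith [sq_nonneg z.1, sq_nonneg z.2]
    have hq : z.2 = 0 := by nlinarith [sq_nonneg z.1, sq_nonneg z.2]
    rw [← h0] at hpos ⊢
    simp only [hp, hq]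
    nlinarith
  have hZ := hG.sub_pos hτ hs0
  have hW := hG.add_pos hτ hκ hs0
  have hode := hG.ode _ hs0
  obtain ⟨-, hβ⟩ := growthExponent_bounds hτ hκ
  clear h1 h2 h3
  generalize hse : z.1 ^ 2 + z.2 ^ 2 = s at *
  generalize z.1 = p at *
  generalize z.2 = q at *
  generalize G s = g at *
  generalize deriv G s = g1 at *
  generalize deriv (deriv G) s = g2 at *
  have hV : 0 < g + 2 * s * g1 := by nlinarith
  have hR : 0 < 2 * g + 10 * s * g1 + 4 * s ^ 2 * g2 := by
    -- The hodograph equation in polar form: it ties the sign of the radial second derivative to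
    -- that of G - sG'.
    have e : (2 * g + 10 * s * g1 + 4 * s ^ 2 * g2) * (1 + τ * s)
        = (1 + κ * s) * (2 * (g - s * g1)) := by linear_combination 2 * s * hode
    have : 0 < (1 + κ * s) * (2 * (g - s * g1)) := by positivity
    rw [← e] at this
    exact pos_of_mul_pos_left this (by positivity)
  have hkey : s ^ 2 * ((2 * g + (10 * p ^ 2 - 2 * q ^ 2) * g1 + 4 * p ^ 2 * (p ^ 2 - q ^ 2) * g2)
      * (-2 * g + (2 * p ^ 2 - 10 * q ^ 2) * g1 + 4 * q ^ 2 * (p ^ 2 - q ^ 2) * g2)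
      - (4 * p * q * (p ^ 2 - q ^ 2) * g2) ^ 2) =
      -((2 * g + 10 * s * g1 + 4 * s ^ 2 * g2) * (2 * (g - s * g1)) * (p ^ 2 - q ^ 2) ^ 2
        + 4 * (g + 2 * s * g1) ^ 2 * (4 * p ^ 2 * q ^ 2)) := by
    rw [← hse]; ring
  have hneg : 0 < (2 * g + 10 * s * g1 + 4 * s ^ 2 * g2) * (2 * (g - s * g1)) * (p ^ 2 - q ^ 2) ^ 2
        + 4 * (g + 2 * s * g1) ^ 2 * (4 * p ^ 2 * q ^ 2) := by
    have hA : 0 < (2 * g + 10 * s * g1 + 4 * s ^ 2 * g2) * (2 * (g - s * g1)) := by positivity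
    have hB : 0 < 4 * (g + 2 * s * g1) ^ 2 := by positivity
    have hsum : (p ^ 2 - q ^ 2) ^ 2 + 4 * p ^ 2 * q ^ 2 = s ^ 2 := by rw [← hse]; ring
    rcases (sq_nonneg (p ^ 2 - q ^ 2)).eq_or_lt with h | h
    · have h4 : 0 < 4 * p ^ 2 * q ^ 2 := by
        have : 0 < s ^ 2 := by positivity
        linarith
      exact add_pos_of_nonneg_of_pos (mul_nonneg hA.le (sq_nonneg _)) (mul_pos hB h4)
    · exact add_pos_of_pos_of_nonneg (mul_pos hA h) (by positivity)
  have hs2 : 0 < s ^ 2 := by positivity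
  by_contra hn
  push Not at hn
  have := mul_nonneg hs2.le hn
  rw [hkey] at this
  linarith

/-- In polar form |DU|² = 4s((G + sG')² cos² 2θ + G² sin² 2θ), and β < 1/2 gives G + sG' ≥ G/2. The
bound yields both properness of DU and the singleton fibre over 0. -/
lemma IsProfile.sq_le_grad_saddle (hG : IsProfile τ κ G) (hτ : 0 ≤ τ) (hκ : 0 < κ) (z : ℝ × ℝ) :
    (z.1 ^ 2 + z.2 ^ 2) * G (z.1 ^ 2 + z.2 ^ 2) ^ 2 ≤
      (grad (saddle G) z).1 ^ 2 + (grad (saddle G) z).2 ^ 2 := by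
  have hs0 : 0 ≤ z.1 ^ 2 + z.2 ^ 2 := by positivity
  rcases hs0.eq_or_lt with h0 | hs
  · rw [← h0]; simp only [zero_mul]; positivity
  obtain ⟨h1, h2⟩ := hG.grad_saddle z
  rw [grad, h1, h2]
  have hpos := hG.pos _ hs0
  have hW := hG.add_pos hτ hκ hs0
  obtain ⟨-, hβ⟩ := growthExponent_bounds hτ hκ
  clear h1 h2
  generalize hse : z.1 ^ 2 + z.2 ^ 2 = s at *
  generalize z.1 = p at *
  generalize z.2 = q at *
  generalize G s = g at *
  generalize deriv G s = g1 at *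
  have hV : g / 2 ≤ g + s * g1 := by nlinarith
  have hkey : s * ((2 * p * (g + (p ^ 2 - q ^ 2) * g1)) ^ 2
      + (-2 * q * (g - (p ^ 2 - q ^ 2) * g1)) ^ 2) =
      4 * ((g + s * g1) ^ 2 * (p ^ 2 - q ^ 2) ^ 2 + g ^ 2 * (4 * p ^ 2 * q ^ 2)) := by
    rw [← hse]; ring
  have h3 : (g / 2) ^ 2 ≤ (g + s * g1) ^ 2 := by gcongr
  refine le_of_mul_le_mul_left ?_ hs
  rw [hkey]
  calc s * (s * g ^ 2) = 4 * ((g / 2) ^ 2 * (p ^ 2 - q ^ 2) ^ 2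
          + (g / 2) ^ 2 * (4 * p ^ 2 * q ^ 2)) := by
        rw [← hse]; ring
    _ ≤ _ := by
        have : (g / 2) ^ 2 ≤ g ^ 2 := by nlinarith
        gcongr

lemma IsProfile.tendsto_grad_saddle (hG : IsProfile τ κ G) (hτ : 0 ≤ τ) (hκ : 0 < κ) :
    Tendsto (grad (saddle G)) (cocompact (ℝ × ℝ)) (cocompact (ℝ × ℝ)) := by
  rw [← Metric.cobounded_eq_cocompact, ← tendsto_norm_atTop_iff_cobounded]
  have hz : Tendsto (fun z : ℝ × ℝ => z.1 ^ 2 + z.2 ^ 2) (Bornology.cobounded (ℝ × ℝ)) atTop := by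
    refine tendsto_atTop_mono (f := fun z : ℝ × ℝ => ‖z‖ ^ 2) (fun z => ?_)
      ((tendsto_pow_atTop two_ne_zero).comp tendsto_norm_cobounded_atTop)
    rcases max_choice ‖z.1‖ ‖z.2‖ with h | h <;>
      rw [Prod.norm_def, h, Real.norm_eq_abs, sq_abs] <;> linarith [sq_nonneg z.1, sq_nonneg z.2]
  have hT : Tendsto (fun z => ‖grad (saddle G) z‖ ^ 2) (Bornology.cobounded (ℝ × ℝ)) atTop := by
    refine tendsto_atTop_mono (fun z => ?_)
      (((hG.tendsto hτ hκ).comp hz).const_mul_atTop (by norm_num : (0 : ℝ) < 1 / 2))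
    have h1 := hG.sq_le_grad_saddle hτ hκ z
    have h2 : (grad (saddle G) z).1 ^ 2 ≤ ‖grad (saddle G) z‖ ^ 2 := by
      rw [← sq_abs, ← Real.norm_eq_abs]; gcongr; exact norm_fst_le _
    have h3 : (grad (saddle G) z).2 ^ 2 ≤ ‖grad (saddle G) z‖ ^ 2 := by
      rw [← sq_abs, ← Real.norm_eq_abs]; gcongr; exact norm_snd_le _
    simp only [Function.comp]
    linarith
  refine tendsto_atTop.mpr fun b => ?_
  filter_upwards [hT.eventually_ge_atTop (b ^ 2)] with z hz
  exact le_of_abs_le (abs_le_of_sq_le_sq hz (norm_nonneg _))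

lemma IsProfile.eq_zero_of_grad_saddle (hG : IsProfile τ κ G) (hτ : 0 ≤ τ) (hκ : 0 < κ)
    {z : ℝ × ℝ} (h : grad (saddle G) z = grad (saddle G) 0) : z = 0 := by
  have h0 : grad (saddle G) 0 = 0 := by
    obtain ⟨h1, h2⟩ := hG.grad_saddle 0
    rw [grad, h1, h2]; simp
  have := hG.sq_le_grad_saddle hτ hκ z
  rw [h, h0] at this
  have hG2 : 0 < G (z.1 ^ 2 + z.2 ^ 2) ^ 2 := by
    have := hG.pos (z.1 ^ 2 + z.2 ^ 2) (by positivity)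
    positivity
  have hs : z.1 ^ 2 + z.2 ^ 2 ≤ 0 := by
    by_contra hn
    push Not at hn
    have := mul_pos hn hG2
    simp at *
    linarith
  ext <;> simp <;> nlinarith [sq_nonneg z.1, sq_nonneg z.2]

end

/-- Dividing the hodograph equation by 2ε produces the profile parameters τ and κ. The hypothesis γ
≠ -1 is exactly what makes κ nonzero, hence positive. -/
theorem exists_entire_solution {γ ε : ℝ} (hεγ : 0 < ε * γ) (hγ : 1 ≤ |γ|) (hγ' : γ ≠ -1) :
    ∃ u : ℝ × ℝ → ℝ, IsEntireSolution (L γ ε) u ∧ ¬ IsAffineLinear u := by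
  have hε : ε ≠ 0 := by rintro rfl; simp at hεγ
  obtain ⟨hτ, hκ⟩ : 0 ≤ (γ - 1) / (2 * ε) ∧ 0 < (γ + 1) / (2 * ε) := by
    rcases param_cases hεγ hγ with ⟨h1, h2⟩ | ⟨h1, h2⟩
    · exact ⟨div_nonneg (by linarith) (by linarith), div_pos (by linarith) (by linarith)⟩
    · have h3 : γ < -1 := lt_of_le_of_ne h2 hγ'
      exact ⟨div_nonneg_of_nonpos (by linarith) (by linarith),
        div_pos_of_neg_of_neg (by linarith) (by linarith)⟩
  obtain ⟨G, hG⟩ := exists_isProfile hτ hκ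
  refine exists_entire_solution_of_hodograph hG.contDiff_saddle (fun z => ?_)
    (fun z => (hG.hessian_det_neg hτ hκ z).ne) (hG.tendsto_grad_saddle hτ hκ)
    (fun z => hG.eq_zero_of_grad_saddle hτ hκ)
  obtain ⟨h1, h2, h3⟩ := hG.hessian_saddle z
  have hode := hG.ode (z.1 ^ 2 + z.2 ^ 2) (by positivity)
  rw [h1, h2, h3]
  simp only [coeffXX, coeffXY, coeffYY]
  generalize G _ = g at *
  generalize deriv G _ = g1 at *
  generalize deriv (deriv G) _ = g2 at *
  field_simp at hode
  linear_combination 2 * (z.1 ^ 2 - z.2 ^ 2) * hode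

end BernsteinPDE

theorem mainTheorem1 (γ ε : ℝ) (hεγ : 0 < ε * γ) (hγ : 1 ≤ |γ|) :
    -- the equation is elliptic
    IsElliptic γ ε ∧
    -- the variational integral is regular
    (∀ w : ℝ, 0 ≤ w → ContDiffAt ℝ ∞ (F γ ε) w ∧ 0 < deriv (F γ ε) w ∧
      0 < deriv (F γ ε) w + 2 * w * deriv (deriv (F γ ε)) w) ∧
    -- `L_{γ,ε}[u] = 0` is its Euler–Lagrange equation
    (∀ u : ℝ × ℝ → ℝ, ContDiff ℝ 2 u →
      (∀ z : ℝ × ℝ, eulerLagrange (lagrangian (F γ ε)) u z = 0 ↔ L γ ε u z = 0) ∧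
      (IsStationaryPoint (lagrangian (F γ ε)) u ↔ ∀ z : ℝ × ℝ, L γ ε u z = 0)) ∧
    -- the function `λ_{γ,ε}` and the Nitsche integrand
    (∀ w : ℝ, 0 ≤ w → 2 * ε + (γ - 1) * w ≠ 0 ∧
      nitscheLambda (F γ ε) w = 2 / (2 * ε + (γ - 1) * w)) ∧
    (∀ w : ℝ, 1 ≤ w → 2 * ε + γ * w ≠ 0 ∧
      nitscheIntegrand (F γ ε) w = 1 / 2 * (1 / (2 * ε + γ * w) + 1 / w)) ∧
    -- in all cases but `γ = -1` the Nitsche integral diverges and the Bernstein property fails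
    (γ ≠ -1 →
      Tendsto (fun R : ℝ => ∫ w in (1 : ℝ)..R, nitscheIntegrand (F γ ε) w) atTop atTop ∧
      Tendsto (fun R : ℝ => ∫ w in (1 : ℝ)..R, 1 / 2 * (1 / (2 * ε + γ * w) + 1 / w))
        atTop atTop ∧
      (∃ u : ℝ × ℝ → ℝ, IsEntireSolution (L γ ε) u ∧ ¬ IsAffineLinear u) ∧
      ¬ HasBernsteinProperty (L γ ε)) := by
  refine ⟨isElliptic_of_param hεγ hγ, fun w hw => F_regular hεγ hγ hw, fun u hu =>
    ⟨eulerLagrange_F_eq_zero_iff hεγ hγ hu, ?_⟩, fun w hw =>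
    ⟨q_ne_zero hεγ hγ hw, nitscheLambda_F hεγ hγ hw⟩, fun w hw =>
    ⟨two_mul_add_ne_zero hεγ hγ hw, nitscheIntegrand_F hεγ hγ hw⟩, fun hγ' => ?_⟩
  · rw [isStationaryPoint_iff (contDiff_infty.mp (contDiff_lagrangian_F hεγ) 2) hu]
    exact forall_congr' (eulerLagrange_F_eq_zero_iff hεγ hγ hu)
  · obtain ⟨u, hu, hna⟩ := exists_entire_solution hεγ hγ hγ'
    exact ⟨tendsto_nitscheIntegral_F hεγ hγ hγ', tendsto_nitscheIntegral hεγ hγ hγ', ⟨u, hu, hna⟩,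
      fun h => hna (h u hu)⟩
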